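/- **Definitions.** A *gauge function* is a continuous non-decreasing function $h:[0,\infty)\to[0,\infty)$ with $\lim_{t\to0^+}h(t)=0$ and $h(t)>0$ for $t>0$. For such $h$, $\mathcal H^h$ denotes the Hausdorff measure on $\mathbb C$ with gauge $h$: $\mathcal H^h(F)=\lim_{\delta\to0}\inf\sum_j h(\operatorname{diam}A_j)$, the infimum being over all countable coverings of $F$ by sets $A_j$ of diameter at most $\delta$; $\mathcal H^s$ is the usual $s$-dimensional Hausdorff measure, i.e. the case $h(t)=t^s$. A homeomorphism $\phi:\mathbb C\to\mathbb C$ is *$K$-quasiconformal* if it is orientation preserving, belongs to $W^{1,2}_{loc}(\mathbb C)$ and satisfies $\max_\alpha|\partial_\alpha\phi|\le K\min_\alpha|\partial_\alpha\phi|$ almost everywhere, where $\partial_\alpha$ is the (weak) derivative in the direction $e^{i\alpha}$. We say that $\mathcal H^s(F)$ is $\sigma$-finite if $F$ is covered by countably many sets of finite $\mathcal H^s$ measure. **Theorem.** Let $K\ge1$, $0<d<2$ and $d'=\frac{2Kd}{2+(K-1)d}$. (a) For every gauge function $h$ with $t^{d'}/h(t)\to0$ as $t\to0^+$ there are a compact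 set $E\subset\mathbb C$ and a $K$-quasiconformal mapping $\phi:\mathbb C\to\mathbb C$ such that $\mathcal H^d(E)=0$ but $\mathcal H^h(\phi(E))>0$. That is, if the implication $\mathcal H^d(E)=0\Rightarrow\mathcal H^{d'}(\phi(E))=0$ holds for all compact $E$ and all $K$-quasiconformal $\phi$, then its conclusion cannot be strengthened in terms of gauge functions. (b) For every gauge function $g$ with $g(t)/t^d\to0$ as $t\to0^+$ there are a compact set $E\subset\mathbb C$ and a $K$-quasiconformal mapping $\phi:\mathbb C\to\mathbb C$ such that $\mathcal H^g(E)=0$ but $\mathcal H^{d'}(\phi(E))$ is not $\sigma$-finite. That is, if the implication "$\mathcal H^d(E)$ $\sigma$-finite $\Rightarrow\mathcal H^{d'}(\phi(E))$ $\sigma$-finite" holds for all compact $E$ and all $K$-quasiconformal $\phi$, then its hypothesis cannot be weakened in terms of gauge functions. -/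

import Mathlib

open MeasureTheory Filter Topology
open scoped ContDiff

/-- A gauge (measure) function: a continuous non-decreasing function on `[0, ∞)`, positive on
`(0, ∞)` and tending to `0` at `0`.  Values at negative arguments are irrelevant. -/
structure IsGauge (h : ℝ → ℝ) : Prop where
  continuousOn : ContinuousOn h (Set.Ici 0)
  monotoneOn : MonotoneOn h (Set.Ici 0)
  tendsto_zero : Tendsto h (𝓝[>] 0) (𝓝 0)
  pos : ∀ t : ℝ, 0 < t → 0 < h t

/-- The Hausdorff measure on the plane with gauge `h`: the limit as `δ → 0` of the infimum of
`∑ h (diam A_j)` over the countable coverings by sets `A_j` of diameter at most `δ`.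
(The value of the gauge at infinite diameter plays no role.) -/
noncomputable def gaugeHausdorffMeasure (h : ℝ → ℝ) : Measure ℂ :=
  Measure.mkMetric fun t : ENNReal => ENNReal.ofReal (h t.toReal)

/-- `f` belongs to `W^{1,2}_loc(ℂ)` (as a complex-valued function on the real plane), and the
field `g` of real-linear maps is its weak derivative. -/
structure HasSobolevDeriv (f : ℂ → ℂ) (g : ℂ → ℂ →L[ℝ] ℂ) : Prop where
  memLp : ∀ k : Set ℂ, IsCompact k → MemLp f 2 (volume.restrict k)
  memLp_deriv : ∀ k : Set ℂ, IsCompact k → MemLp g 2 (volume.restrict k)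
  integral_eq : ∀ u : ℂ → ℝ, ContDiff ℝ ∞ u → HasCompactSupport u → ∀ v : ℂ,
    ∫ z, (fderiv ℝ u z v) • f z = - ∫ z, u z • g z v

/-- A homeomorphism of the plane preserves orientation if the image of every positively oriented
circle has winding number `1` about the image of the centre; `L` is a continuous branch of
`log (φ (c + r e^{iθ}) - φ c)`. -/
def OrientationPreserving (φ : ℂ ≃ₜ ℂ) : Prop :=
  ∀ (c : ℂ) (r : ℝ), 0 < r → ∃ L : ℝ → ℂ, Continuous L ∧
    (∀ θ : ℝ, Complex.exp (L θ) = φ (circleMap c r θ) - φ c) ∧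
    L (2 * Real.pi) = L 0 + 2 * Real.pi * Complex.I

/-- `K`-quasiconformal self-maps of the plane: orientation preserving homeomorphisms in
`W^{1,2}_loc` with `max_α |∂_α φ| ≤ K min_α |∂_α φ|` almost everywhere, where `∂_α` is the
derivative in the direction `e^{iα}`. -/
def IsQuasiconformal (K : ℝ) (φ : ℂ ≃ₜ ℂ) : Prop :=
  OrientationPreserving φ ∧
    ∃ g : ℂ → ℂ →L[ℝ] ℂ, HasSobolevDeriv φ g ∧
      ∀ᵐ z : ℂ, ∀ α β : ℝ,
        ‖g z (Complex.exp (α * Complex.I))‖ ≤ K * ‖g z (Complex.exp (β * Complex.I))‖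

/-- The measure `μ` is σ-finite on the set `s`: `s` is covered by countably many sets of finite
measure. -/
def SigmaFiniteOn (μ : Measure ℂ) (s : Set ℂ) : Prop :=
  ∃ A : ℕ → Set ℂ, s ⊆ ⋃ n, A n ∧ ∀ n, μ (A n) < ⊤

/-! Both parts use one construction: a Cantor set `E` together with a map `Φ` built from radial
stretchings. At step `n` each disk of generation `n` receives `k n ^ 2` smaller disks of relative
radius `R n = 1 / (2 * k n)`, centred on a grid. In each of them a `K`-quasiconformal stretching
maps the concentric disk of relative radius `σ n ^ K` by a homothety onto the one of relative radius
`σ n`. The radii of the generations are thus `s` in the domain and `t` in the target.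

The distortion does not accumulate: `φ n` is a similarity on each disk of generation `n`
(`φ_of_mem_Z`), and the next stretchings act inside these disks. All `φ n` therefore have distortion
at most `K` almost everywhere. They converge uniformly with their inverses, and they agree with the
limit off sets `D n` whose area tends to `0`. The inequality `|Df|^2 ≤ K |det Df|` and the area
formula bound the energy on a set by the area of its image, so the pointwise derivative of `Φ` is
its weak derivative (`hasSobolevDeriv_of_tendstoUniformly`).

For sizes, take `σ n = q * R n ^ γ` with `γ = (2 - d) / (K * d)`. Then `d + γ K d = 2` and `d' + γ
d' = 2`, so `N n * s n ^ d` and `N n * t n ^ d'` are exact geometric progressions, whatever the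
integers `k n` (`exists_of_thresholds`). These are left free to make the radii decrease as fast as
the gauge requires. Coverings by the disks of `D n` give the null measures in the domain
(`mkMetric_E_eq_zero`). The uniform measure `μ` on the image gives the lower bounds, by the mass
distribution principle (`μ_le_mkMetric`).

In (a) `q = 1`: both progressions are `(1/4)^n`, so `E` is null in dimension `d`, while the loss
`4^n` in the mass estimate is absorbed by the gauge `h`. In (b) `q ^ d' = 16`: the target
progression is `4^n`, hence `μ ≤ ε • μH[d']` for every `ε > 0`, and sets of finite measure are
`μ`-null. The growth in the domain is absorbed by the smallness of `g`. -/

/-! ### Radial stretchings of the unit disk -/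

/-- The value of `r` truncated to the interval `[a, 1]`. -/
noncomputable def clampOne (a r : ℝ) : ℝ := max a (min r 1)

lemma clampOne_pos {a : ℝ} (ha : 0 < a) (r : ℝ) : 0 < clampOne a r := lt_max_of_lt_left ha

lemma clampOne_of_one_le {a r : ℝ} (ha : a ≤ 1) (hr : 1 ≤ r) : clampOne a r = 1 := by
  simp [clampOne, hr, ha]

lemma clampOne_of_le {a r : ℝ} (hr : r ≤ a) : clampOne a r = a := by
  simp [clampOne, hr]

lemma clampOne_of_mem {a r : ℝ} (h1 : a ≤ r) (h2 : r ≤ 1) : clampOne a r = r := by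
  simp [clampOne, h1, h2]

lemma continuous_clampOne (a : ℝ) : Continuous (clampOne a) := by
  unfold clampOne; fun_prop

lemma monotone_clampOne (a : ℝ) : Monotone (clampOne a) := fun _ _ h => by
  unfold clampOne; gcongr

/-- The radial map `w ↦ c ^ e • w`, where `c` is the modulus of `w` truncated to `[a, 1]`. -/
noncomputable def radialMap (a e : ℝ) (w : ℂ) : ℂ := ((clampOne a ‖w‖) ^ e : ℝ) • w

lemma continuous_radialMap {a : ℝ} (ha : 0 < a) (e : ℝ) : Continuous (radialMap a e) := by
  unfold radialMap
  refine Continuous.smul (Continuous.rpow_const ((continuous_clampOne a).comp continuous_norm)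
    fun w => Or.inl (clampOne_pos ha _).ne') continuous_id

lemma radialMap_of_one_le {a : ℝ} (ha : a ≤ 1) (e : ℝ) {w : ℂ} (hw : 1 ≤ ‖w‖) :
    radialMap a e w = w := by
  simp [radialMap, clampOne_of_one_le ha hw]

lemma radialMap_of_le {a e : ℝ} {w : ℂ} (hw : ‖w‖ ≤ a) : radialMap a e w = (a ^ e : ℝ) • w := by
  rw [radialMap, clampOne_of_le hw]

lemma norm_radialMap {a : ℝ} (ha : 0 < a) (e : ℝ) (w : ℂ) :
    ‖radialMap a e w‖ = clampOne a ‖w‖ ^ e * ‖w‖ := by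
  rw [radialMap, norm_smul, Real.norm_of_nonneg (Real.rpow_nonneg (clampOne_pos ha _).le _)]

/-- Truncating the modulus of the image to the image interval recovers the power `1 + e` of the
truncated modulus. This is what makes the inverse of a radial map radial as well. -/
lemma clampOne_rpow_mul {a e r : ℝ} (ha : 0 < a) (ha1 : a ≤ 1) (he : 0 < 1 + e) :
    clampOne (a ^ (1 + e)) (clampOne a r ^ e * r) = clampOne a r ^ (1 + e) := by
  rcases le_total r a with h | h
  · rw [clampOne_of_le h, clampOne_of_le]
    rw [add_comm, Real.rpow_add ha, Real.rpow_one]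
    gcongr
  rcases le_total r 1 with h1 | h1
  · have hr : 0 < r := ha.trans_le h
    have : r ^ e * r = r ^ (1 + e) := by rw [add_comm, Real.rpow_add hr, Real.rpow_one]
    rw [clampOne_of_mem h h1, this, clampOne_of_mem]
    · exact Real.rpow_le_rpow ha.le h he.le
    · exact Real.rpow_le_one hr.le h1 he.le
  · rw [clampOne_of_one_le ha1 h1, clampOne_of_one_le]
    · simp
    · exact Real.rpow_le_one ha.le ha1 he.le
    · simpa using h1

lemma radialMap_radialMap {a e e' : ℝ} (ha : 0 < a) (ha1 : a ≤ 1) (he : 0 < 1 + e)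
    (hee : (1 + e) * (1 + e') = 1) (w : ℂ) :
    radialMap (a ^ (1 + e)) e' (radialMap a e w) = w := by
  have hc := clampOne_pos ha ‖w‖
  conv_lhs => rw [radialMap, norm_radialMap ha, clampOne_rpow_mul ha ha1 he, radialMap]
  rw [smul_smul, ← Real.rpow_mul hc.le, ← Real.rpow_add hc]
  have : (1 + e) * e' + e = 0 := by linear_combination hee
  simp [this]

/-- The factor `p` decreases with the modulus while `r * p r` increases. For `‖v‖ ≤ ‖w‖` this bounds
`(p ‖v‖ - p ‖w‖) * ‖v‖` by `p ‖w‖ * (‖w‖ - ‖v‖)`, and `p ≤ a ^ e` because of the truncation. -/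
lemma exists_lipschitzWith_radialMap {a e : ℝ} (ha : 0 < a) (he : 0 < 1 + e) (he0 : e ≤ 0) :
    ∃ C, LipschitzWith C (radialMap a e) := by
  set p : ℝ → ℝ := fun r => clampOne a r ^ e with hp
  have p_nonneg : ∀ r, 0 ≤ p r := fun r => Real.rpow_nonneg (clampOne_pos ha _).le _
  have p_anti : Antitone p := fun r s h =>
    Real.rpow_le_rpow_of_nonpos (clampOne_pos ha _) (monotone_clampOne a h) he0
  have p_le : ∀ r, p r ≤ a ^ e := fun r =>
    Real.rpow_le_rpow_of_nonpos ha (le_max_left _ _) he0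
  have q_mono : ∀ r s, 0 ≤ r → r ≤ s → r * p r ≤ s * p s := by
    have key : ∀ r, 0 ≤ r → r * p r = (r / clampOne a r) * clampOne a r ^ (1 + e) := by
      intro r _
      have hc := clampOne_pos ha r
      rw [Real.rpow_add hc, Real.rpow_one, hp]
      field_simp
    intro r s hr hrs
    rw [key r hr, key s (hr.trans hrs)]
    have hcr := clampOne_pos ha r
    have hcs := clampOne_pos ha s
    have h1 : r / clampOne a r ≤ s / clampOne a s := by
      rw [div_le_div_iff₀ hcr hcs]
      have hs := hr.trans hrs
      unfold clampOne
      rw [mul_max_of_nonneg _ _ hr, mul_max_of_nonneg _ _ hs, mul_min_of_nonneg _ _ hr,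
        mul_min_of_nonneg _ _ hs, mul_comm r s, mul_one, mul_one]
      gcongr
    gcongr
    · exact div_nonneg (hr.trans hrs) hcs.le
    · exact monotone_clampOne a hrs
  have main : ∀ v w : ℂ, ‖v‖ ≤ ‖w‖ →
      ‖radialMap a e w - radialMap a e v‖ ≤ 2 * a ^ e * ‖w - v‖ := by
    intro v w hvw
    have h1 : radialMap a e w - radialMap a e v =
        p ‖w‖ • (w - v) + (p ‖w‖ - p ‖v‖) • v := by
      simp only [radialMap, hp, smul_sub, sub_smul]; abel
    have h2 : ‖(p ‖w‖ - p ‖v‖) • v‖ ≤ p ‖w‖ * ‖w - v‖ := by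
      rw [norm_smul, Real.norm_eq_abs, abs_sub_comm, abs_of_nonneg (sub_nonneg.2 (p_anti hvw))]
      have h3 := q_mono _ _ (norm_nonneg v) hvw
      have h4 : ‖w‖ - ‖v‖ ≤ ‖w - v‖ := norm_sub_norm_le w v
      nlinarith [p_nonneg ‖w‖]
    have h5 : p ‖w‖ * ‖w - v‖ ≤ a ^ e * ‖w - v‖ := by gcongr; exact p_le _
    rw [h1]
    refine (norm_add_le _ _).trans ?_
    rw [norm_smul, Real.norm_of_nonneg (p_nonneg _)]
    linarith
  refine ⟨Real.toNNReal (2 * a ^ e), LipschitzWith.of_dist_le_mul fun w v => ?_⟩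
  rw [Real.coe_toNNReal _ (by positivity), dist_eq_norm, dist_eq_norm]
  rcases le_total ‖v‖ ‖w‖ with h | h
  · exact main v w h
  · rw [norm_sub_rev, norm_sub_rev w]; exact main w v h

/-- The `K`-quasiconformal radial stretching of the unit disk which maps the disk of radius
`σ ^ K` onto the disk of radius `σ` by a homothety and is the identity outside the unit disk. -/
noncomputable def radialStretch (K σ : ℝ) (hK : 1 ≤ K) (hσ : 0 < σ) (hσ1 : σ ≤ 1) : ℂ ≃ₜ ℂ where
  toFun := radialMap (σ ^ K) (1 / K - 1)
  invFun := radialMap σ (K - 1)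
  left_inv w := by
    have hK0 : 0 < K := by linarith
    have := radialMap_radialMap (a := σ ^ K) (e := 1 / K - 1) (e' := K - 1)
      (Real.rpow_pos_of_pos hσ K) (Real.rpow_le_one hσ.le hσ1 hK0.le)
      (by simpa using hK0) (by field_simp; ring) w
    rwa [← Real.rpow_mul hσ.le, show K * (1 + (1 / K - 1)) = 1 by field_simp; ring,
      Real.rpow_one] at this
  right_inv w := by
    have hK0 : 0 < K := by linarith
    have := radialMap_radialMap (a := σ) (e := K - 1) (e' := 1 / K - 1)
      hσ hσ1 (by simpa using hK0) (by field_simp; ring) w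
    rwa [show 1 + (K - 1) = K by ring] at this
  continuous_toFun := continuous_radialMap (Real.rpow_pos_of_pos hσ K) _
  continuous_invFun := continuous_radialMap hσ _

section
variable {K σ : ℝ} (hK : 1 ≤ K) (hσ : 0 < σ) (hσ1 : σ ≤ 1)

lemma radialStretch_of_one_le {w : ℂ} (hw : 1 ≤ ‖w‖) : radialStretch K σ hK hσ hσ1 w = w :=
  radialMap_of_one_le (Real.rpow_le_one hσ.le hσ1 (by linarith)) _ hw

lemma radialStretch_of_le {w : ℂ} (hw : ‖w‖ ≤ σ ^ K) :
    radialStretch K σ hK hσ hσ1 w = (σ / σ ^ K : ℝ) • w := by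
  have h : radialStretch K σ hK hσ hσ1 w = _ := radialMap_of_le hw
  rw [h, ← Real.rpow_mul hσ.le, mul_sub, mul_one_div_cancel (by linarith), mul_one,
    Real.rpow_sub hσ, Real.rpow_one]

lemma exists_lipschitzWith_radialStretch :
    ∃ C, LipschitzWith C (radialStretch K σ hK hσ hσ1) :=
  exists_lipschitzWith_radialMap (Real.rpow_pos_of_pos hσ K)
    (by simp; linarith) (by rw [sub_nonpos]; exact div_le_one_of_le₀ hK (by linarith))

end

/-! ### Linear distortion and the derivative of a radial stretching -/

/-- A real linear map of the plane with linear distortion at most `K`. -/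
structure HasDistortion (K : ℝ) (D : ℂ →L[ℝ] ℂ) : Prop where
  norm_le : ∀ u v : ℂ, ‖u‖ = ‖v‖ → ‖D u‖ ≤ K * ‖D v‖
  sq_norm_le : ‖D‖ ^ 2 ≤ K * |D.det|

lemma HasDistortion.smul {K : ℝ} {D : ℂ →L[ℝ] ℂ} (h : HasDistortion K D) (r : ℝ) :
    HasDistortion K (r • D) where
  norm_le u v huv := by
    simp only [smul_apply, norm_smul]
    have := mul_le_mul_of_nonneg_left (h.norm_le u v huv) (norm_nonneg r)
    linarith
  sq_norm_le := by
    have : (r • D).det = r ^ 2 * D.det := by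
      simp [ContinuousLinearMap.det, LinearMap.det_smul, Complex.finrank_real_complex]
    rw [this, norm_smul, abs_mul, mul_pow, abs_of_nonneg (sq_nonneg r), Real.norm_eq_abs, sq_abs]
    nlinarith [h.sq_norm_le, sq_nonneg r]

lemma hasDistortion_id {K : ℝ} (hK : 1 ≤ K) : HasDistortion K (ContinuousLinearMap.id ℝ ℂ) where
  norm_le u v huv := by simp only [ContinuousLinearMap.id_apply, huv]; nlinarith [norm_nonneg v]
  sq_norm_le := by simp [ContinuousLinearMap.det]; exact hK

/-- `f` is differentiable at `z` with linear distortion at most `K`. -/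
def HasDistortionAt (K : ℝ) (f : ℂ → ℂ) (z : ℂ) : Prop :=
  ∃ D : ℂ →L[ℝ] ℂ, HasFDerivAt f D z ∧ HasDistortion K D

lemma HasDistortionAt.congr {K : ℝ} {f g : ℂ → ℂ} {z : ℂ} (h : HasDistortionAt K f z)
    (hfg : g =ᶠ[𝓝 z] f) : HasDistortionAt K g z :=
  let ⟨D, hD, hK⟩ := h
  ⟨D, hD.congr_of_eventuallyEq hfg, hK⟩

lemma hasDistortionAt_id {K : ℝ} (hK : 1 ≤ K) (z : ℂ) : HasDistortionAt K (fun z => z) z :=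
  ⟨_, hasFDerivAt_id z, hasDistortion_id hK⟩

lemma HasDistortionAt.const_add_smul {K : ℝ} {f : ℂ → ℂ} {z : ℂ} (h : HasDistortionAt K f z)
    (c : ℂ) (r : ℝ) : HasDistortionAt K (fun z => c + r • f z) z :=
  let ⟨D, hD, hK⟩ := h
  ⟨r • D, (hD.const_smul r).const_add c, hK.smul r⟩

lemma HasDistortionAt.comp_smul_sub {K : ℝ} {f : ℂ → ℂ} {c z : ℂ} {r : ℝ}
    (h : HasDistortionAt K f (r • (z - c))) : HasDistortionAt K (fun z => f (r • (z - c))) z := by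
  obtain ⟨D, hD, hK⟩ := h
  refine ⟨r • D, ?_, hK.smul r⟩
  have h1 : HasFDerivAt (fun z : ℂ => r • (z - c)) (r • ContinuousLinearMap.id ℝ ℂ) z :=
    ((hasFDerivAt_id z).sub_const c).const_smul r
  convert! hD.comp z h1 using 1
  ext
  all_goals simp

/-- The real linear map `v ↦ m (v - β ⟨w, v⟩ w / |w|²)`. -/
noncomputable def radialDeriv (m β : ℝ) (w : ℂ) : ℂ →L[ℝ] ℂ :=
  m • (ContinuousLinearMap.id ℝ ℂ - (β / ‖w‖ ^ 2) • (innerSL ℝ w).smulRight w)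

lemma radialDeriv_apply_re (m β : ℝ) (w v : ℂ) : (radialDeriv m β w v).re =
    m * (v.re - β / (w.re * w.re + w.im * w.im) * (w.re * v.re + w.im * v.im) * w.re) := by
  simp [radialDeriv, ← Complex.normSq_eq_norm_sq, Complex.normSq_apply, Complex.inner,
    -Complex.real_smul, Complex.smul_re, -mul_eq_mul_left_iff]
  ring

lemma radialDeriv_apply_im (m β : ℝ) (w v : ℂ) : (radialDeriv m β w v).im =
    m * (v.im - β / (w.re * w.re + w.im * w.im) * (w.re * v.re + w.im * v.im) * w.im) := by
  simp [radialDeriv, ← Complex.normSq_eq_norm_sq, Complex.normSq_apply, Complex.inner,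
    -Complex.real_smul, Complex.smul_im, -mul_eq_mul_left_iff]
  ring

lemma det_radialDeriv (m β : ℝ) {w : ℂ} (hw : w ≠ 0) :
    (radialDeriv m β w).det = m ^ 2 * (1 - β) := by
  have hw' : w.re ^ 2 + w.im ^ 2 ≠ 0 := by
    rw [sq, sq, ← Complex.normSq_apply]; simpa using hw
  rw [ContinuousLinearMap.det, ← LinearMap.det_toMatrix Complex.basisOneI, Matrix.det_fin_two]
  simp only [LinearMap.toMatrix_apply, Complex.coe_basisOneI_repr, ContinuousLinearMap.coe_coe,
    Complex.coe_basisOneI, radialDeriv_apply_re, radialDeriv_apply_im, Matrix.cons_val_zero,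
    Matrix.cons_val_one, Complex.one_re, Complex.one_im, Complex.I_re, Complex.I_im]
  field_simp
  ring

lemma norm_sq_radialDeriv (m β : ℝ) {w : ℂ} (hw : w ≠ 0) (v : ℂ) :
    ‖radialDeriv m β w v‖ ^ 2 =
      m ^ 2 * (‖v‖ ^ 2 - (2 * β - β ^ 2) * (inner ℝ w v / ‖w‖) ^ 2) := by
  have hw' : w.re ^ 2 + w.im ^ 2 ≠ 0 := by
    rw [sq, sq, ← Complex.normSq_apply]; simpa using hw
  rw [div_pow]
  simp only [← Complex.normSq_eq_norm_sq, Complex.normSq_apply, Complex.inner,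
    radialDeriv_apply_re, radialDeriv_apply_im, Complex.mul_re, Complex.conj_re, Complex.conj_im]
  field_simp
  ring

/-- The singular values are `m` in the tangential direction and `m / K` in the radial one. -/
lemma hasDistortion_radialDeriv {m K : ℝ} (hm : 0 < m) (hK : 1 ≤ K) {w : ℂ} (hw : w ≠ 0) :
    HasDistortion K (radialDeriv m (1 - 1 / K) w) := by
  have hK0 : 0 < K := by linarith
  have hb : 2 * (1 - 1 / K) - (1 - 1 / K) ^ 2 = 1 - (1 / K) ^ 2 := by ring
  have hK1 : 0 ≤ 1 - (1 / K) ^ 2 := by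
    rw [sub_nonneg, sq_le_one_iff₀ (by positivity)]
    exact div_le_one_of_le₀ hK hK0.le
  have hx : ∀ v : ℂ, (inner ℝ w v / ‖w‖) ^ 2 ≤ ‖v‖ ^ 2 := by
    intro v
    have h0 : 0 < ‖w‖ := norm_pos_iff.2 hw
    rw [← sq_abs, abs_div, abs_norm]
    gcongr
    rw [div_le_iff₀ h0, mul_comm]
    exact abs_real_inner_le_norm w v
  have upper : ∀ v : ℂ, ‖radialDeriv m (1 - 1 / K) w v‖ ≤ m * ‖v‖ := by
    intro v
    refine le_of_sq_le_sq ?_ (by positivity)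
    rw [norm_sq_radialDeriv m _ hw, mul_pow, hb]
    have : 0 ≤ (1 - (1 / K) ^ 2) * (inner ℝ w v / ‖w‖) ^ 2 := by positivity
    gcongr
    linarith
  have lower : ∀ v : ℂ, m * ‖v‖ ≤ K * ‖radialDeriv m (1 - 1 / K) w v‖ := by
    intro v
    refine le_of_sq_le_sq ?_ (by positivity)
    rw [mul_pow K, norm_sq_radialDeriv m _ hw, mul_pow, hb]
    have h1 := mul_le_mul_of_nonneg_left (hx v) hK1
    have h2 : ‖v‖ ^ 2 = K ^ 2 * (‖v‖ ^ 2 - (1 - (1 / K) ^ 2) * ‖v‖ ^ 2) := by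
      field_simp; ring
    calc m ^ 2 * ‖v‖ ^ 2 = K ^ 2 * (m ^ 2 * (‖v‖ ^ 2 - (1 - (1 / K) ^ 2) * ‖v‖ ^ 2)) := by
          rw [mul_left_comm, ← h2]
      _ ≤ _ := by gcongr
  refine ⟨fun u v huv => (upper u).trans (huv ▸ lower v), ?_⟩
  rw [det_radialDeriv m _ hw, sub_sub_cancel, abs_of_nonneg (by positivity)]
  have h1 : ‖radialDeriv m (1 - 1 / K) w‖ ≤ m :=
    ContinuousLinearMap.opNorm_le_bound _ hm.le upper
  calc _ ≤ m ^ 2 := by gcongr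
    _ = _ := by field_simp

lemma hasFDerivAt_norm_rpow_smul (e : ℝ) {w : ℂ} (hw : w ≠ 0) :
    HasFDerivAt (fun w : ℂ => (‖w‖ ^ e : ℝ) • w) (radialDeriv (‖w‖ ^ e) (-e) w) w := by
  have h0 : 0 < ‖w‖ := norm_pos_iff.2 hw
  have h1 : HasFDerivAt (fun w : ℂ => ‖w‖ ^ 2) _ w := (hasStrictFDerivAt_norm_sq w).hasFDerivAt
  have h2 := h1.rpow_const (p := e / 2) (Or.inl (by positivity))
  have h3 := h2.smul (hasFDerivAt_id w)
  have h4 : (fun w : ℂ => ((‖w‖ ^ 2) ^ (e / 2) : ℝ) • id w) = fun w : ℂ => (‖w‖ ^ e : ℝ) • w := by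
    funext w
    rw [← Real.rpow_natCast, ← Real.rpow_mul (norm_nonneg w)]
    simp [mul_div_cancel₀]
  have h5 : (‖w‖ ^ 2) ^ (e / 2) = ‖w‖ ^ e := by
    rw [← Real.rpow_natCast, ← Real.rpow_mul (norm_nonneg w)]
    simp [mul_div_cancel₀]
  rw [← h4]
  convert! h3 using 1
  rw [Real.rpow_sub (by positivity), h5]
  ext
  all_goals
    simp [radialDeriv]
    field_simp
    ring

lemma hasDistortionAt_radialStretch {K σ : ℝ} (hK : 1 ≤ K) (hσ : 0 < σ) (hσ1 : σ ≤ 1) {w : ℂ}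
    (h1 : ‖w‖ ≠ 1) (h2 : ‖w‖ ≠ σ ^ K) :
    HasDistortionAt K (radialStretch K σ hK hσ hσ1) w := by
  rcases lt_or_gt_of_ne h1 with h1 | h1
  · rcases lt_or_gt_of_ne h2 with h2 | h2
    · refine (((hasDistortionAt_id hK w).const_add_smul 0 (σ / σ ^ K)).congr ?_)
      filter_upwards [(isOpen_lt continuous_norm continuous_const).mem_nhds h2] with z hz
      rw [radialStretch_of_le hK hσ hσ1 (le_of_lt hz), zero_add]
    · have hw : w ≠ 0 := norm_pos_iff.1 ((Real.rpow_pos_of_pos hσ K).trans h2)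
      have hd := hasFDerivAt_norm_rpow_smul (1 / K - 1) hw
      rw [neg_sub] at hd
      refine HasDistortionAt.congr ⟨_, hd, hasDistortion_radialDeriv
        (Real.rpow_pos_of_pos (norm_pos_iff.2 hw) _) hK hw⟩ ?_
      filter_upwards [(isOpen_lt continuous_norm continuous_const).mem_nhds h1,
        (isOpen_lt continuous_const continuous_norm).mem_nhds h2] with z hz1 hz2
      change radialMap _ _ z = _
      rw [radialMap, clampOne_of_mem (le_of_lt hz2) (le_of_lt hz1)]
  · refine (hasDistortionAt_id hK w).congr ?_
    filter_upwards [(isOpen_lt continuous_const continuous_norm).mem_nhds h1] with z hz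
    exact radialStretch_of_one_le hK hσ hσ1 (le_of_lt hz)

/-! ### Copies of a map on a packing of disks -/

/-- The points of `Z` are the centres of disks of radius `ρ` with disjoint interiors. -/
def IsPacking (Z : Finset ℂ) (ρ : ℝ) : Prop :=
  ∀ c ∈ Z, ∀ c' ∈ Z, c ≠ c' → 2 * ρ ≤ ‖c - c'‖

/-- The map which acts as a rescaled copy of `F` on each disk of radius `ρ` centred at a point of
`Z`, for maps `F` which are the identity outside the unit disk. -/
noncomputable def spreadMap (Z : Finset ℂ) (ρ : ℝ) (F : ℂ → ℂ) (z : ℂ) : ℂ :=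
  z + ∑ c ∈ Z, ρ • (F (ρ⁻¹ • (z - c)) - ρ⁻¹ • (z - c))

section spread
variable {Z : Finset ℂ} {ρ : ℝ} {F G : ℂ → ℂ}

lemma one_le_norm_inv_smul (hρ : 0 < ρ) {w : ℂ} : 1 ≤ ‖ρ⁻¹ • w‖ ↔ ρ ≤ ‖w‖ := by
  rw [norm_smul, norm_inv, Real.norm_of_nonneg hρ.le, inv_mul_eq_div, one_le_div hρ]

lemma norm_inv_smul_le_one (hρ : 0 < ρ) {w : ℂ} : ‖ρ⁻¹ • w‖ ≤ 1 ↔ ‖w‖ ≤ ρ := by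
  rw [norm_smul, norm_inv, Real.norm_of_nonneg hρ.le, inv_mul_eq_div, div_le_one hρ]

lemma spreadMap_of_forall_le (hρ : 0 < ρ) (hF : ∀ w, 1 ≤ ‖w‖ → F w = w) {z : ℂ}
    (hz : ∀ c ∈ Z, ρ ≤ ‖z - c‖) : spreadMap Z ρ F z = z := by
  rw [spreadMap, Finset.sum_eq_zero, add_zero]
  intro c hc
  rw [hF _ ((one_le_norm_inv_smul hρ).2 (hz c hc)), sub_self, smul_zero]

lemma spreadMap_of_mem (hρ : 0 < ρ) (hZ : IsPacking Z ρ) (hF : ∀ w, 1 ≤ ‖w‖ → F w = w)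
    {z c : ℂ} (hc : c ∈ Z) (hz : ‖z - c‖ ≤ ρ) :
    spreadMap Z ρ F z = c + ρ • F (ρ⁻¹ • (z - c)) := by
  rw [spreadMap, Finset.sum_eq_single_of_mem c hc]
  · rw [smul_sub, smul_inv_smul₀ hρ.ne']; ring
  · intro c' hc' hne
    have h1 := hZ c hc c' hc' hne.symm
    have h2 : ‖c - c'‖ ≤ ‖z - c‖ + ‖z - c'‖ := by
      rw [norm_sub_rev z c]
      simpa using norm_add_le (c - z) (z - c')
    rw [hF _ ((one_le_norm_inv_smul hρ).2 (by linarith)), sub_self, smul_zero]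

lemma norm_spreadMap_sub_le (hρ : 0 < ρ) (hZ : IsPacking Z ρ) (hF : ∀ w, 1 ≤ ‖w‖ → F w = w)
    (hF1 : ∀ w, ‖w‖ ≤ 1 → ‖F w‖ ≤ 1) {z c : ℂ} (hc : c ∈ Z) (hz : ‖z - c‖ ≤ ρ) :
    ‖spreadMap Z ρ F z - c‖ ≤ ρ := by
  rw [spreadMap_of_mem hρ hZ hF hc hz, add_sub_cancel_left, norm_smul, Real.norm_of_nonneg hρ.le]
  exact mul_le_of_le_one_right hρ.le (hF1 _ ((norm_inv_smul_le_one hρ).2 hz))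

lemma spreadMap_spreadMap (hρ : 0 < ρ) (hZ : IsPacking Z ρ) (hF : ∀ w, 1 ≤ ‖w‖ → F w = w)
    (hF1 : ∀ w, ‖w‖ ≤ 1 → ‖F w‖ ≤ 1) (hG : ∀ w, 1 ≤ ‖w‖ → G w = w) (hGF : ∀ w, G (F w) = w)
    (z : ℂ) : spreadMap Z ρ G (spreadMap Z ρ F z) = z := by
  by_cases h : ∃ c ∈ Z, ‖z - c‖ ≤ ρ
  · obtain ⟨c, hc, hz⟩ := h
    rw [spreadMap_of_mem hρ hZ hG hc (norm_spreadMap_sub_le hρ hZ hF hF1 hc hz),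
      spreadMap_of_mem hρ hZ hF hc hz, add_sub_cancel_left, inv_smul_smul₀ hρ.ne', hGF,
      smul_inv_smul₀ hρ.ne', add_sub_cancel]
  · push Not at h
    have h' : ∀ c ∈ Z, ρ ≤ ‖z - c‖ := fun c hc => (h c hc).le
    rw [spreadMap_of_forall_le hρ hF h', spreadMap_of_forall_le hρ hG h']

/-- Writing the map as the identity plus a finite sum of displacements avoids any gluing along the
circles. -/
lemma continuous_spreadMap (hF : Continuous F) : Continuous (spreadMap Z ρ F) := by
  unfold spreadMap; fun_prop

end spread

/-- The exterior is already filled by its own fixed points, so injectivity keeps the disk inside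
itself. -/
lemma Homeomorph.norm_le_one_of_eq_self {F : ℂ ≃ₜ ℂ} (hF : ∀ w, 1 ≤ ‖w‖ → F w = w) {w : ℂ}
    (hw : ‖w‖ ≤ 1) : ‖F w‖ ≤ 1 := by
  by_contra! h
  have h1 := F.injective (hF _ h.le)
  rw [h1] at h
  exact absurd hw (not_le.2 h)

lemma Homeomorph.symm_eq_self {F : ℂ ≃ₜ ℂ} (hF : ∀ w, 1 ≤ ‖w‖ → F w = w) (w : ℂ)
    (hw : 1 ≤ ‖w‖) : F.symm w = w := by
  rw [Homeomorph.symm_apply_eq, hF w hw]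

/-- `spreadMap` as a homeomorphism. -/
noncomputable def spreadHomeo (Z : Finset ℂ) (ρ : ℝ) (F : ℂ ≃ₜ ℂ) (hρ : 0 < ρ)
    (hZ : IsPacking Z ρ) (hF : ∀ w, 1 ≤ ‖w‖ → F w = w) : ℂ ≃ₜ ℂ where
  toFun := spreadMap Z ρ F
  invFun := spreadMap Z ρ F.symm
  left_inv := spreadMap_spreadMap hρ hZ hF (fun _ => F.norm_le_one_of_eq_self hF)
    (F.symm_eq_self hF) F.symm_apply_apply
  right_inv := spreadMap_spreadMap hρ hZ (F.symm_eq_self hF)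
    (fun _ => F.symm.norm_le_one_of_eq_self (F.symm_eq_self hF)) hF F.apply_symm_apply
  continuous_toFun := continuous_spreadMap F.continuous
  continuous_invFun := continuous_spreadMap F.symm.continuous

lemma exists_lipschitzWith_spreadMap (Z : Finset ℂ) (ρ : ℝ) {F : ℂ → ℂ}
    (hF : ∃ C, LipschitzWith C F) : ∃ C, LipschitzWith C (spreadMap Z ρ F) := by
  obtain ⟨C, hC⟩ := hF
  have hs : ∃ C', LipschitzWith C'
      (fun z : ℂ => ∑ c ∈ Z, ρ • (F (ρ⁻¹ • (z - c)) - ρ⁻¹ • (z - c))) := by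
    induction Z using Finset.induction_on with
    | empty => exact ⟨0, by simp⟩
    | insert a s ha ih =>
      obtain ⟨C', hC'⟩ := ih
      have h1 : LipschitzWith (‖ρ⁻¹‖₊ * 1) (fun z : ℂ => ρ⁻¹ • (z - a)) := by
        refine (lipschitzWith_smul ρ⁻¹).comp ?_
        exact LipschitzWith.of_dist_le_mul fun x y => by simp
      have h2 := (lipschitzWith_smul ρ).comp ((hC.comp h1).sub h1)
      have h3 := h2.add hC'
      refine ⟨‖ρ‖₊ * (C * (‖ρ⁻¹‖₊ * 1) + ‖ρ⁻¹‖₊ * 1) + C', ?_⟩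
      simp only [Finset.sum_insert ha]
      exact h3
  obtain ⟨C', hC'⟩ := hs
  exact ⟨_, LipschitzWith.id.add hC'⟩

lemma hasDistortionAt_spreadMap {K ρ : ℝ} {Z : Finset ℂ} {F : ℂ → ℂ} (hK : 1 ≤ K) (hρ : 0 < ρ)
    (hZ : IsPacking Z ρ) (hF : ∀ w, 1 ≤ ‖w‖ → F w = w) {z : ℂ}
    (h1 : ∀ c ∈ Z, ‖z - c‖ ≠ ρ) (h2 : ∀ c ∈ Z, ‖z - c‖ < ρ → HasDistortionAt K F (ρ⁻¹ • (z - c))) :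
    HasDistortionAt K (spreadMap Z ρ F) z := by
  by_cases h : ∃ c ∈ Z, ‖z - c‖ < ρ
  · obtain ⟨c, hc, hz⟩ := h
    refine ((h2 c hc hz).comp_smul_sub.const_add_smul c ρ).congr ?_
    have ho : IsOpen {z : ℂ | ‖z - c‖ < ρ} := isOpen_lt (by fun_prop) (by fun_prop)
    filter_upwards [ho.mem_nhds hz] with y hy
    exact spreadMap_of_mem hρ hZ hF hc (le_of_lt hy)
  · push Not at h
    refine (hasDistortionAt_id hK z).congr ?_
    have ho : ∀ᶠ y in 𝓝 z, ∀ c ∈ Z, ρ < ‖y - c‖ := by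
      rw [Finset.eventually_all]
      intro c hc
      have ho : IsOpen {z : ℂ | ρ < ‖z - c‖} := isOpen_lt (by fun_prop) (by fun_prop)
      exact ho.mem_nhds (lt_of_le_of_ne (h c hc) (h1 c hc).symm)
    filter_upwards [ho] with y hy
    exact spreadMap_of_forall_le hρ hF fun c hc => (hy c hc).le

lemma ae_hasDistortionAt_spreadMap_radialStretch {K σ ρ : ℝ} (hK : 1 ≤ K) (hσ : 0 < σ)
    (hσ1 : σ ≤ 1) {Z : Finset ℂ} (hρ : 0 < ρ) (hZ : IsPacking Z ρ) :
    ∀ᵐ z : ℂ, HasDistortionAt K (spreadMap Z ρ (radialStretch K σ hK hσ hσ1)) z := by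
  have hsphere : ∀ r : ℝ, ∀ᵐ z : ℂ, ∀ c ∈ Z, ‖z - c‖ ≠ r := by
    intro r
    rw [Filter.eventually_all_finset]
    intro c _
    have : volume (Metric.sphere c r) = 0 := Measure.addHaar_sphere _ _ _
    filter_upwards [measure_eq_zero_iff_ae_notMem.1 this] with z hz
    simpa [dist_eq_norm] using hz
  filter_upwards [hsphere ρ, hsphere (ρ * σ ^ K)] with z h1 h2
  refine hasDistortionAt_spreadMap hK hρ hZ (fun w hw => radialStretch_of_one_le hK hσ hσ1 hw) h1
    fun c hc hz => hasDistortionAt_radialStretch hK hσ hσ1 ?_ ?_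
  · rw [norm_smul, norm_inv, Real.norm_of_nonneg hρ.le, inv_mul_eq_div, Ne, div_eq_one_iff_eq hρ.ne']
    exact h1 c hc
  · rw [norm_smul, norm_inv, Real.norm_of_nonneg hρ.le, inv_mul_eq_div, Ne, div_eq_iff hρ.ne',
      mul_comm]
    exact h2 c hc

/-! ### Winding numbers and orientation -/

/-- `γ` has a continuous logarithm on `ℝ` which increases by `2πi` over `[0, 2π]`. -/
def HasWindingOne (γ : ℝ → ℂ) : Prop :=
  ∃ L : ℝ → ℂ, Continuous L ∧ (∀ θ : ℝ, Complex.exp (L θ) = γ θ) ∧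
    L (2 * Real.pi) = L 0 + 2 * Real.pi * Complex.I

/-- Rouché's argument: `γ' / γ` stays in the disk of radius `1` about `1`, where the principal
logarithm is continuous. Adding it to `L` changes nothing over a period. -/
lemma HasWindingOne.of_norm_sub_lt {γ γ' : ℝ → ℂ} (h : HasWindingOne γ) (hγ : Continuous γ)
    (hγ' : Continuous γ') (hp : γ (2 * Real.pi) = γ 0) (hp' : γ' (2 * Real.pi) = γ' 0)
    (hlt : ∀ θ, ‖γ' θ - γ θ‖ < ‖γ θ‖) : HasWindingOne γ' := by
  obtain ⟨L, hL, hexp, hend⟩ := h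
  have hne : ∀ θ, γ θ ≠ 0 := fun θ => norm_pos_iff.1 ((norm_nonneg _).trans_lt (hlt θ))
  have hslit : ∀ θ, γ' θ / γ θ ∈ Complex.slitPlane := by
    intro θ
    have h1 : γ' θ / γ θ = 1 + (γ' θ - γ θ) / γ θ := by field_simp [hne θ]; ring
    rw [h1]
    refine Complex.mem_slitPlane_of_norm_lt_one ?_
    rw [norm_div, div_lt_one (norm_pos_iff.2 (hne θ))]
    exact hlt θ
  refine ⟨fun θ => L θ + Complex.log (γ' θ / γ θ),
    hL.add (Continuous.clog (hγ'.div hγ hne) hslit), fun θ => ?_, ?_⟩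
  · rw [Complex.exp_add, hexp, Complex.exp_log (Complex.slitPlane_ne_zero (hslit θ)),
      mul_div_cancel₀ _ (hne θ)]
  · simp only [hp, hp', hend]; ring

/-- A homeomorphism of the plane which is the identity outside a disk preserves orientation. -/
lemma orientationPreserving_of_eq_self {φ : ℂ ≃ₜ ℂ} {M : ℝ} (hM : 0 ≤ M)
    (h : ∀ z, M ≤ ‖z‖ → φ z = z) : OrientationPreserving φ := by
  set γ : ℂ × ℝ → ℝ → ℂ := fun p θ => φ (circleMap p.1 p.2 θ) - φ p.1 with hγ
  have hcont2 : Continuous fun q : (ℂ × ℝ) × ℝ => γ q.1 q.2 := by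
    simp only [hγ, circleMap]
    exact (φ.continuous.comp (by fun_prop)).sub (φ.continuous.comp (by fun_prop))
  have hcont : ∀ p, Continuous (γ p) := fun p => hcont2.comp (Continuous.prodMk_right p)
  have hper : ∀ p θ, γ p (θ + 2 * Real.pi) = γ p θ := fun p θ => by
    simp only [hγ, periodic_circleMap p.1 p.2 θ]
  have hper0 : ∀ p, γ p (2 * Real.pi) = γ p 0 := fun p => by simpa using hper p 0
  have hne : ∀ p : ℂ × ℝ, 0 < p.2 → ∀ θ, γ p θ ≠ 0 := by
    intro p hp θ h0
    have h1 := φ.injective (sub_eq_zero.1 h0)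
    exact circleMap_ne_center hp.ne' h1
  -- The winding property is locally constant in the pair (centre, radius). The factor `1 / 2` makes
  -- Rouché's condition hold in both directions, and periodicity reduces uniformity in `θ` to a
  -- compact interval.
  have hloc : ∀ p : ℂ × ℝ, 0 < p.2 → ∀ᶠ q in 𝓝 p, ∀ θ, ‖γ q θ - γ p θ‖ < ‖γ p θ‖ / 2 := by
    intro p hp
    have h1 : ∀ᶠ q in 𝓝 p, ∀ θ ∈ Set.Icc 0 (2 * Real.pi), ‖γ q θ - γ p θ‖ < ‖γ p θ‖ / 2 := by
      refine isCompact_Icc.eventually_forall_of_forall_eventually fun θ _ => ?_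
      have ho : IsOpen {z : (ℂ × ℝ) × ℝ | ‖γ z.1 z.2 - γ p z.2‖ < ‖γ p z.2‖ / 2} := by
        have := (hcont p).comp (continuous_snd : Continuous (Prod.snd : (ℂ × ℝ) × ℝ → ℝ))
        exact isOpen_lt (hcont2.sub this).norm (this.norm.div_const 2)
      exact ho.mem_nhds (by simpa using hne p hp θ)
    filter_upwards [h1] with q hq θ
    obtain ⟨θ', hθ', heq⟩ := Function.Periodic.exists_mem_Ico₀
      (f := fun θ => (γ q θ, γ p θ)) (fun θ => by simp only [hper]) Real.two_pi_pos θ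
    simp only [Prod.mk.injEq] at heq
    rw [heq.1, heq.2]
    exact hq θ' (Set.Ico_subset_Icc_self hθ')
  have hconn : IsPreconnected {p : ℂ × ℝ | 0 < p.2} := by
    have : {p : ℂ × ℝ | 0 < p.2} = Set.univ ×ˢ Set.Ioi (0 : ℝ) := by ext; simp
    rw [this]
    exact isPreconnected_univ.prod isPreconnected_Ioi
  -- The circle of radius `1` about `M + 2` and its centre lie where `φ` is the identity.
  have hbase : HasWindingOne (γ ((M + 2 : ℝ), 1)) := by
    refine ⟨fun θ => θ * Complex.I, by fun_prop, fun θ => ?_, by push_cast; simp⟩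
    have h1 : φ ((M + 2 : ℝ) : ℂ) = (M + 2 : ℝ) := by
      refine h _ ?_
      rw [Complex.norm_real, Real.norm_of_nonneg (by linarith)]; linarith
    have h2 : φ (circleMap ((M + 2 : ℝ) : ℂ) 1 θ) = circleMap ((M + 2 : ℝ) : ℂ) 1 θ := by
      refine h _ ?_
      have h3 := norm_sub_norm_le ((M + 2 : ℝ) : ℂ) (-(Complex.exp (θ * Complex.I)))
      rw [norm_neg, Complex.norm_exp_ofReal_mul_I, Complex.norm_real,
        Real.norm_of_nonneg (by linarith), sub_neg_eq_add] at h3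
      simp only [circleMap, Complex.ofReal_one, one_mul]
      linarith
    simp only [hγ, h1, h2]
    simp [circleMap]
  intro c r hr
  have key := hconn.induction₂' (fun p q => HasWindingOne (γ p) → HasWindingOne (γ q))
    (fun p hp => ?_) (fun p q s _ _ _ h1 h2 h3 => h2 (h1 h3))
    (x := ((M + 2 : ℝ), 1)) (y := (c, r)) (by simp) hr
  · exact key hbase
  · refine eventually_nhdsWithin_of_eventually_nhds ?_
    filter_upwards [hloc p hp] with q hq
    refine ⟨fun h1 => h1.of_norm_sub_lt (hcont _) (hcont _) (hper0 _) (hper0 _) fun θ => ?_,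
      fun h1 => h1.of_norm_sub_lt (hcont _) (hcont _) (hper0 _) (hper0 _) fun θ => ?_⟩
    · have := norm_pos_iff.2 (hne p hp θ)
      linarith [hq θ]
    · have h2 := norm_sub_norm_le (γ p θ) (γ q θ)
      have h3 := norm_sub_rev (γ p θ) (γ q θ)
      linarith [hq θ]

/-! ### Energy estimates, weak derivatives and uniform limits -/

lemma HasDistortionAt.sq_norm_fderiv_le {K : ℝ} {f : ℂ → ℂ} {z : ℂ} (h : HasDistortionAt K f z) :
    DifferentiableAt ℝ f z ∧ ‖fderiv ℝ f z‖ ^ 2 ≤ K * |(fderiv ℝ f z).det| := by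
  obtain ⟨D, hD, hK⟩ := h
  rw [hD.fderiv]
  exact ⟨hD.differentiableAt, hK.sq_norm_le⟩

section energy
variable {K : ℝ} {f : ℂ ≃ₜ ℂ}

/-- The integrand is at most `K` times the Jacobian, and the area formula for the injective map `f`
integrates the Jacobian. Only points of differentiability enter, so an inequality results without
knowing whether `f` maps null sets to null sets. -/
lemma setLIntegral_sq_fderiv_le (hK : 0 ≤ K) (h : ∀ᵐ z : ℂ, HasDistortionAt K f z) {S : Set ℂ}
    (hS : MeasurableSet S) :
    ∫⁻ z in S, ‖fderiv ℝ f z‖ₑ ^ (2 : ℝ) ≤ ENNReal.ofReal K * volume (f '' S) := by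
  set T := {z | DifferentiableAt ℝ f z} with hT
  have hTm : MeasurableSet T := measurableSet_of_differentiableAt ℝ f
  have hae : (S ∩ T : Set ℂ) =ᵐ[volume] S := by
    filter_upwards [h] with z hz
    have h1 : z ∈ T := hz.sq_norm_fderiv_le.1
    exact propext ⟨fun h => h.1, fun h => ⟨h, h1⟩⟩
  calc ∫⁻ z in S, ‖fderiv ℝ f z‖ₑ ^ (2 : ℝ)
      ≤ ∫⁻ z in S, ENNReal.ofReal K * ENNReal.ofReal |(fderiv ℝ f z).det| := by
        refine lintegral_mono_ae (ae_restrict_of_ae ?_)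
        filter_upwards [h] with z hz
        rw [← ENNReal.ofReal_mul hK, ← ofReal_norm, ENNReal.ofReal_rpow_of_nonneg (norm_nonneg _)
          zero_le_two]
        exact ENNReal.ofReal_le_ofReal (by simpa using hz.sq_norm_fderiv_le.2)
    _ = ∫⁻ z in S ∩ T, ENNReal.ofReal K * ENNReal.ofReal |(fderiv ℝ f z).det| :=
        (setLIntegral_congr hae).symm
    _ = ENNReal.ofReal K * ∫⁻ z in S ∩ T, ENNReal.ofReal |(fderiv ℝ f z).det| :=
        lintegral_const_mul' _ _ ENNReal.ofReal_ne_top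
    _ = ENNReal.ofReal K * volume (f '' (S ∩ T)) := by
        rw [lintegral_abs_det_fderiv_eq_addHaar_image volume (hS.inter hTm)
          (fun z hz => (DifferentiableAt.hasFDerivAt hz.2).hasFDerivWithinAt) f.injective.injOn]
    _ ≤ _ := by gcongr; exact Set.inter_subset_left

/-- Cauchy–Schwarz. On sets of small area the derivative has small integral, uniformly over maps
whose images have bounded area. -/
lemma setLIntegral_fderiv_le (hK : 0 ≤ K) (h : ∀ᵐ z : ℂ, HasDistortionAt K f z) {S : Set ℂ}
    (hS : MeasurableSet S) :
    ∫⁻ z in S, ‖fderiv ℝ f z‖ₑ ≤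
      volume S ^ (1 / 2 : ℝ) * (ENNReal.ofReal K * volume (f '' S)) ^ (1 / 2 : ℝ) := by
  have h1 := ENNReal.lintegral_mul_le_Lp_mul_Lq (volume.restrict S)
    Real.HolderConjugate.two_two (f := fun _ => 1) (g := fun z => ‖fderiv ℝ f z‖ₑ)
    aemeasurable_const (measurable_fderiv ℝ f).enorm.aemeasurable
  simp only [Pi.mul_apply, one_mul, ENNReal.one_rpow, lintegral_const, Measure.restrict_apply_univ]
    at h1
  refine h1.trans ?_
  gcongr
  exact setLIntegral_sq_fderiv_le hK h hS

lemma memLp_fderiv (hK : 0 ≤ K) (h : ∀ᵐ z : ℂ, HasDistortionAt K f z) {k : Set ℂ}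
    (hk : IsCompact k) : MemLp (fderiv ℝ f) 2 (volume.restrict k) := by
  refine ⟨(measurable_fderiv ℝ f).aestronglyMeasurable, ?_⟩
  rw [eLpNorm_lt_top_iff_lintegral_rpow_enorm_lt_top (by simp) (by simp)]
  refine (setLIntegral_sq_fderiv_le hK h hk.measurableSet).trans_lt ?_
  exact ENNReal.mul_lt_top ENNReal.ofReal_lt_top (hk.image f.continuous).measure_lt_top

lemma integrable_smul_fderiv (hK : 0 ≤ K) (h : ∀ᵐ z : ℂ, HasDistortionAt K f z) {u : ℂ → ℝ}
    (hu : Continuous u) (hcu : HasCompactSupport u) (v : ℂ) :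
    Integrable fun z => u z • fderiv ℝ f z v := by
  obtain ⟨C, hC⟩ := hcu.exists_bound_of_continuous hu
  have hm := (measurable_fderiv_apply_const ℝ f v)
  refine ⟨(hu.measurable.smul hm).aestronglyMeasurable, ?_⟩
  have h1 : ∀ z, ‖u z • fderiv ℝ f z v‖ₑ ≤
      (tsupport u).indicator (fun z => ENNReal.ofReal (C * ‖v‖) * ‖fderiv ℝ f z‖ₑ) z := by
    intro z
    by_cases hz : z ∈ tsupport u
    · have hC0 : 0 ≤ C := (norm_nonneg _).trans (hC z)
      rw [Set.indicator_of_mem hz, ← ofReal_norm, ← ofReal_norm (fderiv ℝ f z),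
        ← ENNReal.ofReal_mul (by positivity), norm_smul, mul_assoc, mul_comm ‖v‖]
      refine ENNReal.ofReal_le_ofReal (mul_le_mul (hC z) ?_ (norm_nonneg _) hC0)
      exact ContinuousLinearMap.le_opNorm _ _
    · simp [image_eq_zero_of_notMem_tsupport hz]
  refine (lintegral_mono h1).trans_lt ?_
  rw [lintegral_indicator (isClosed_tsupport u).measurableSet,
    lintegral_const_mul' _ _ ENNReal.ofReal_ne_top]
  refine ENNReal.mul_lt_top ENNReal.ofReal_lt_top ?_
  refine (setLIntegral_fderiv_le hK h (isClosed_tsupport u).measurableSet).trans_lt ?_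
  have hcu' : IsCompact (tsupport u) := hcu
  refine ENNReal.mul_lt_top (ENNReal.rpow_lt_top_of_nonneg (by norm_num) hcu'.measure_lt_top.ne)
    (ENNReal.rpow_lt_top_of_nonneg (by norm_num) (ENNReal.mul_lt_top ENNReal.ofReal_lt_top
      (hcu'.image f.continuous).measure_lt_top).ne)

end energy

lemma LipschitzWith.integral_fderiv_smul_eq {f : ℂ → ℂ} {C : NNReal} (hf : LipschitzWith C f)
    {u : ℂ → ℝ} (hu : ContDiff ℝ ∞ u) (hcu : HasCompactSupport u) (v : ℂ)
    (hint : Integrable fun z => u z • fderiv ℝ f z v) :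
    ∫ z, (fderiv ℝ u z v) • f z = - ∫ z, u z • fderiv ℝ f z v := by
  obtain ⟨D, hD⟩ := hu.lipschitzWith_of_hasCompactSupport hcu (by simp)
  have hint' : Integrable fun z => (fderiv ℝ u z v) • f z := by
    refine Continuous.integrable_of_hasCompactSupport ?_ ?_
    · exact ((hu.continuous_fderiv (by simp)).clm_apply continuous_const).smul hf.continuous
    · exact (hcu.fderiv_apply ℝ v).smul_right
  -- Integration by parts is applied to real Lipschitz functions, hence to the real and imaginary
  -- parts separately.
  have key : ∀ l : ℂ →L[ℝ] ℝ,
      l (∫ z, (fderiv ℝ u z v) • f z) = l (- ∫ z, u z • fderiv ℝ f z v) := by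
    intro l
    rw [map_neg, ← l.integral_comp_comm hint', ← l.integral_comp_comm hint]
    have h1 := LipschitzWith.integral_lineDeriv_mul_eq (μ := volume)
      (l.lipschitz.comp hf) hD hcu v
    have h2 : ∀ᵐ z : ℂ, lineDeriv ℝ (l ∘ f) z v * u z = l (u z • fderiv ℝ f z v) := by
      filter_upwards [hf.ae_differentiableAt (μ := volume)] with z hz
      have h3 : HasFDerivAt (l ∘ f) (l.comp (fderiv ℝ f z)) z :=
        l.hasFDerivAt.comp z hz.hasFDerivAt
      rw [h3.hasLineDerivAt v |>.lineDeriv]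
      simp [mul_comm, -Complex.real_smul]
    have h4 : ∀ z : ℂ, lineDeriv ℝ u z (-v) * (l ∘ f) z = -l (fderiv ℝ u z v • f z) := by
      intro z
      rw [(hu.differentiable (by simp) z).lineDeriv_eq_fderiv]
      simp [-Complex.real_smul]
    rw [integral_congr_ae h2] at h1
    simp only [h4, integral_neg] at h1
    rw [h1, neg_neg]
  exact Complex.ext (key Complex.reCLM) (key Complex.imCLM)

/-- A uniform limit of Lipschitz maps of bounded distortion, such that the `n`-th map
agrees with the limit off a closed set `D n` of small measure, has a weak derivative. -/
lemma hasSobolevDeriv_of_tendstoUniformly {K : ℝ} (hK : 0 ≤ K) {f : ℂ ≃ₜ ℂ} {F : ℕ → ℂ ≃ₜ ℂ}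
    (hLip : ∀ n, ∃ C, LipschitzWith C (F n)) (hF : ∀ n, ∀ᵐ z : ℂ, HasDistortionAt K (F n) z)
    (hf : ∀ᵐ z : ℂ, HasDistortionAt K f z) {D : ℕ → Set ℂ} (hD : ∀ n, IsClosed (D n))
    (hvol : Tendsto (fun n => volume (D n)) atTop (𝓝 0)) (heq : ∀ n, ∀ z ∉ D n, f z = F n z)
    (hconv : TendstoUniformly (fun n => F n) f atTop) {B : Set ℂ} (hB : IsCompact B)
    (hFB : ∀ n, F n '' D n ⊆ B) (hfB : ∀ n, f '' D n ⊆ B) :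
    HasSobolevDeriv f (fderiv ℝ f) where
  memLp k hk := by
    obtain ⟨C, hC⟩ := hk.exists_bound_of_continuousOn f.continuous.continuousOn
    have : IsFiniteMeasure (volume.restrict k) := ⟨by simpa using hk.measure_lt_top⟩
    refine MemLp.of_bound f.continuous.aestronglyMeasurable C ?_
    exact (ae_restrict_iff' hk.measurableSet).2 (Eventually.of_forall hC)
  memLp_deriv k hk := memLp_fderiv hK hf hk
  integral_eq u hu hcu v := by
    have hint := fun n => integrable_smul_fderiv hK (hF n) hu.continuous hcu v
    have hintf := integrable_smul_fderiv hK hf hu.continuous hcu v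
    obtain ⟨C, hC⟩ := hcu.exists_bound_of_continuous hu.continuous
    have hC0 : 0 ≤ C := (norm_nonneg _).trans (hC 0)
    have lim1 : Tendsto (fun n => ∫ z, u z • fderiv ℝ (F n) z v) atTop
        (𝓝 (∫ z, u z • fderiv ℝ f z v)) := by
      refine tendsto_integral_of_L1 _ hintf.aestronglyMeasurable (Eventually.of_forall hint) ?_
      -- Off the closed set `D n` the two maps agree near each point, so their derivatives cancel.
      -- On `D n` each derivative is estimated by Cauchy–Schwarz, with image area at most that of
      -- `B`.
      have hb : ∀ n, ∫⁻ z, ‖u z • fderiv ℝ (F n) z v - u z • fderiv ℝ f z v‖ₑ ≤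
          ENNReal.ofReal (C * ‖v‖) * (2 * (volume (D n) ^ (1 / 2 : ℝ) *
            (ENNReal.ofReal K * volume B) ^ (1 / 2 : ℝ))) := by
        intro n
        have h1 : ∀ z, ‖u z • fderiv ℝ (F n) z v - u z • fderiv ℝ f z v‖ₑ ≤
            (D n).indicator (fun z => ENNReal.ofReal (C * ‖v‖) *
              (‖fderiv ℝ (F n) z‖ₑ + ‖fderiv ℝ f z‖ₑ)) z := by
          intro z
          by_cases hz : z ∈ D n
          · rw [Set.indicator_of_mem hz, ← ofReal_norm, ← ofReal_norm (fderiv ℝ f z),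
              ← ofReal_norm (fderiv ℝ (F n) z), ← ENNReal.ofReal_add (norm_nonneg _) (norm_nonneg _),
              ← ENNReal.ofReal_mul (by positivity), ← smul_sub, norm_smul]
            refine ENNReal.ofReal_le_ofReal ?_
            rw [mul_assoc]
            refine mul_le_mul (hC z) ?_ (norm_nonneg _) hC0
            have h2 := (fderiv ℝ (F n) z).le_opNorm v
            have h3 := (fderiv ℝ f z).le_opNorm v
            have h4 := norm_sub_le (fderiv ℝ (F n) z v) (fderiv ℝ f z v)
            linarith
          · have h2 : (f : ℂ → ℂ) =ᶠ[𝓝 z] F n := by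
              filter_upwards [(hD n).isOpen_compl.mem_nhds hz] with y hy using heq n y hy
            rw [h2.fderiv_eq]
            simp
        refine (lintegral_mono h1).trans ?_
        rw [lintegral_indicator (hD n).measurableSet,
          lintegral_const_mul' _ _ ENNReal.ofReal_ne_top,
          lintegral_add_left (measurable_fderiv ℝ (F n)).enorm, two_mul]
        gcongr
        · refine (setLIntegral_fderiv_le hK (hF n) (hD n).measurableSet).trans ?_
          gcongr
          exact hFB n
        · refine (setLIntegral_fderiv_le hK hf (hD n).measurableSet).trans ?_
          gcongr
          exact hfB n
      refine tendsto_of_tendsto_of_tendsto_of_le_of_le tendsto_const_nhds ?_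
        (fun _ => zero_le) hb
      have hfin : (ENNReal.ofReal K * volume B) ^ (1 / 2 : ℝ) ≠ ⊤ :=
        (ENNReal.rpow_lt_top_of_nonneg (by norm_num) (ENNReal.mul_lt_top ENNReal.ofReal_lt_top
          hB.measure_lt_top).ne).ne
      have h5 : Tendsto (fun n => volume (D n) ^ (1 / 2 : ℝ)) atTop (𝓝 0) := by
        have := (ENNReal.continuous_rpow_const (y := 1 / 2)).tendsto 0 |>.comp hvol
        simpa [Function.comp_def] using this
      have h6 := ENNReal.Tendsto.mul_const h5 (Or.inr hfin)
      have h7 := ENNReal.Tendsto.const_mul (a := 2) h6 (Or.inr (by simp))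
      have h8 := ENNReal.Tendsto.const_mul (a := ENNReal.ofReal (C * ‖v‖)) h7
        (Or.inr ENNReal.ofReal_ne_top)
      simpa using h8
    have hcd : Continuous fun z => fderiv ℝ u z v :=
      (hu.continuous_fderiv (by simp)).clm_apply continuous_const
    have hsd : HasCompactSupport fun z => fderiv ℝ u z v := hcu.fderiv_apply ℝ v
    have hid : ∀ g : ℂ → ℂ, Continuous g → Integrable fun z => fderiv ℝ u z v • g z :=
      fun g hg => (hcd.smul hg).integrable_of_hasCompactSupport hsd.smul_right
    have lim2 : Tendsto (fun n => ∫ z, fderiv ℝ u z v • F n z) atTop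
        (𝓝 (∫ z, fderiv ℝ u z v • f z)) := by
      have hi1 : Integrable fun z => fderiv ℝ u z v := hcd.integrable_of_hasCompactSupport hsd
      rw [Metric.tendstoUniformly_iff] at hconv
      rw [Metric.tendsto_atTop]
      intro ε hε
      set I := ∫ z, ‖fderiv ℝ u z v‖ with hI
      have hI0 : 0 ≤ I := integral_nonneg fun _ => norm_nonneg _
      obtain ⟨N, hN⟩ := eventually_atTop.1 (hconv (ε / (I + 1)) (by positivity))
      refine ⟨N, fun n hn => ?_⟩
      rw [dist_eq_norm, ← integral_sub (hid _ (F n).continuous) (hid _ f.continuous)]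
      have h1 : ∀ z, ‖fderiv ℝ u z v • F n z - fderiv ℝ u z v • f z‖ ≤
          ‖fderiv ℝ u z v‖ * (ε / (I + 1)) := by
        intro z
        rw [← smul_sub, norm_smul, norm_sub_rev, ← dist_eq_norm]
        gcongr
        exact (hN n hn z).le
      calc _ ≤ ∫ z, ‖fderiv ℝ u z v‖ * (ε / (I + 1)) :=
            norm_integral_le_of_norm_le (hi1.norm.mul_const _) (Eventually.of_forall h1)
        _ = I * (ε / (I + 1)) := by rw [integral_mul_const]
        _ < ε := by
          rw [mul_div_assoc', div_lt_iff₀ (by positivity)]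
          linarith
    refine tendsto_nhds_unique lim2 (lim1.neg.congr fun n => ?_)
    obtain ⟨L, hL⟩ := hLip n
    exact (hL.integral_fderiv_smul_eq hu hcu v (hint n)).symm

/-- Controlling the inverses as well makes them converge to a continuous map, which inverts the
limit. -/
lemma exists_homeomorph_tendstoUniformly {F : ℕ → ℂ ≃ₜ ℂ} {C r : ℝ} (hr : r < 1)
    (h1 : ∀ n z, dist (F n z) (F (n + 1) z) ≤ C * r ^ n)
    (h2 : ∀ n z, dist ((F n).symm z) ((F (n + 1)).symm z) ≤ C * r ^ n) (hr0 : 0 ≤ r) :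
    ∃ f : ℂ ≃ₜ ℂ, TendstoUniformly (fun n => F n) f atTop := by
  have key : ∀ G : ℕ → ℂ → ℂ, (∀ n z, dist (G n z) (G (n + 1) z) ≤ C * r ^ n) →
      ∃ g : ℂ → ℂ, TendstoUniformly G g atTop := by
    intro G hG
    choose g hg using fun z => cauchySeq_tendsto_of_complete
      (cauchySeq_of_le_geometric r C hr fun n => hG n z)
    refine ⟨g, Metric.tendstoUniformly_iff.2 fun ε hε => ?_⟩
    have h0 : Tendsto (fun n => C * r ^ n / (1 - r)) atTop (𝓝 0) := by
      simpa using ((tendsto_pow_atTop_nhds_zero_of_lt_one hr0 hr).const_mul C).div_const (1 - r)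
    filter_upwards [h0.eventually_lt_const hε] with n hn z
    rw [dist_comm]
    exact (dist_le_of_le_geometric_of_tendsto r C hr (fun n => hG n z) (hg z) n).trans_lt hn
  obtain ⟨f, hf⟩ := key _ h1
  obtain ⟨g, hg⟩ := key _ h2
  have hfc : Continuous f := hf.continuous (Frequently.of_forall fun n => (F n).continuous)
  have hgc : Continuous g := hg.continuous (Frequently.of_forall fun n => (F n).symm.continuous)
  refine ⟨⟨⟨f, g, fun z => ?_, fun z => ?_⟩, hfc, hgc⟩, hf⟩
  · have := hg.tendsto_comp hgc.continuousAt (hf.tendsto_at z)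
    exact tendsto_nhds_unique this (by simp)
  · have := hf.tendsto_comp hfc.continuousAt (hg.tendsto_at z)
    exact tendsto_nhds_unique this (by simp)

/-! ### Grids in the unit disk -/

/-- The centres of the squares of side `1 / k` of a partition of the unit square centred at `0`. -/
noncomputable def gridPoint (k : ℕ) (p : Fin k × Fin k) : ℂ :=
  ⟨(2 * (p.1 : ℝ) + 1 - k) / (2 * k), (2 * (p.2 : ℝ) + 1 - k) / (2 * k)⟩

section grid
variable {k : ℕ}

/-- Each coordinate is at most `1 / 2 - 1 / (2 * k)` in modulus, and the norm is at most their sum.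
Hence the disk of radius `1 / (2 * k)` about a grid point stays in the unit disk. -/
lemma norm_gridPoint_le (p : Fin k × Fin k) : ‖gridPoint k p‖ ≤ 1 - 1 / k := by
  have hk : 0 < (k : ℝ) := by exact_mod_cast p.1.pos
  have h : ∀ i : Fin k, |(2 * (i : ℝ) + 1 - k) / (2 * k)| ≤ 1 / 2 - 1 / (2 * k) := by
    intro i
    have h1 : (i : ℝ) + 1 ≤ k := by exact_mod_cast i.2
    have h2 : (0 : ℝ) ≤ i := by positivity
    have h3 : (1 : ℝ) / 2 - 1 / (2 * k) = (k - 1) / (2 * k) := by field_simp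
    rw [abs_div, abs_of_pos (a := 2 * (k : ℝ)) (by positivity), h3]
    gcongr
    rw [abs_le]
    constructor <;> linarith
  have h1 := Complex.norm_le_abs_re_add_abs_im (gridPoint k p)
  have h2 := h p.1
  have h3 := h p.2
  have h4 : (1 : ℝ) / (2 * k) = 1 / k / 2 := by field_simp
  simp only [gridPoint] at h1 ⊢
  linarith

lemma abs_fst_sub_le (p q : Fin k × Fin k) :
    |(p.1 : ℝ) - q.1| ≤ k * ‖gridPoint k p - gridPoint k q‖ := by
  have hk : 0 < (k : ℝ) := by exact_mod_cast p.1.pos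
  have h1 := Complex.abs_re_le_norm (gridPoint k p - gridPoint k q)
  have h2 : (gridPoint k p - gridPoint k q).re = ((p.1 : ℝ) - q.1) / k := by
    simp only [gridPoint, Complex.sub_re]
    field_simp
    ring
  rw [h2, abs_div, abs_of_pos hk, div_le_iff₀ hk] at h1
  linarith

lemma abs_snd_sub_le (p q : Fin k × Fin k) :
    |(p.2 : ℝ) - q.2| ≤ k * ‖gridPoint k p - gridPoint k q‖ := by
  have hk : 0 < (k : ℝ) := by exact_mod_cast p.1.pos
  have h1 := Complex.abs_im_le_norm (gridPoint k p - gridPoint k q)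
  have h2 : (gridPoint k p - gridPoint k q).im = ((p.2 : ℝ) - q.2) / k := by
    simp only [gridPoint, Complex.sub_im]
    field_simp
    ring
  rw [h2, abs_div, abs_of_pos hk, div_le_iff₀ hk] at h1
  linarith

lemma le_norm_gridPoint_sub {p q : Fin k × Fin k} (h : p ≠ q) :
    1 / k ≤ ‖gridPoint k p - gridPoint k q‖ := by
  have hk : 0 < (k : ℝ) := by exact_mod_cast p.1.pos
  have hint : ∀ i j : Fin k, i ≠ j → (1 : ℝ) ≤ |(i : ℝ) - j| := by
    intro i j hij
    have h1 : ((i : ℕ) : ℤ) - (j : ℕ) ≠ 0 := by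
      rw [sub_ne_zero]; exact_mod_cast Fin.val_ne_of_ne hij
    exact_mod_cast Int.one_le_abs h1
  rw [div_le_iff₀ hk, mul_comm]
  by_cases h1 : p.1 = q.1
  · exact (hint _ _ fun h2 => h (Prod.ext h1 h2)).trans (abs_snd_sub_le p q)
  · exact (hint _ _ h1).trans (abs_fst_sub_le p q)

end grid

/-! ### The iterated construction and its quasiconformal limit -/

/-- The parameters of an iterated construction: in the `n`-th step each disk is replaced by
`k n ^ 2` disks placed on a square grid, on which a radial stretching with ratio `σ n` acts. -/
structure CantorData where
  /-- the distortion -/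
  K : ℝ
  /-- the number of subdivisions of the sides -/
  k : ℕ → ℕ
  /-- the contraction ratios -/
  σ : ℕ → ℝ
  one_le_K : 1 ≤ K
  k_pos : ∀ n, 0 < k n
  σ_pos : ∀ n, 0 < σ n
  σ_le : ∀ n, σ n ≤ 1 / 2

namespace CantorData
variable (P : CantorData)

/-- The relative radius of the disks of the packing. -/
noncomputable def R (n : ℕ) : ℝ := 1 / (2 * P.k n)

/-- The radius of the disks of generation `n` in the domain. -/
noncomputable def s : ℕ → ℝ
  | 0 => 1
  | n + 1 => s n * (P.R n * P.σ n ^ P.K)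

/-- The radius of the disks of generation `n` in the target. -/
noncomputable def t : ℕ → ℝ
  | 0 => 1
  | n + 1 => t n * (P.R n * P.σ n)

/-- The number of disks of generation `n`. -/
def N (n : ℕ) : ℕ := ∏ j ∈ Finset.range n, P.k j ^ 2

/-- The centres of the disks of generation `n` in the domain. -/
noncomputable def Z : ℕ → Finset ℂ
  | 0 => {0}
  | n + 1 => Finset.image₂ (fun z p => z + P.s n • gridPoint (P.k n) p) (Z n) Finset.univ

/-- The union of the disks of generation `n` in the domain. -/
def D (n : ℕ) : Set ℂ := ⋃ z ∈ P.Z n, Metric.closedBall z (P.s n)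

lemma σ_lt_one (n : ℕ) : P.σ n < 1 := (P.σ_le n).trans_lt (by norm_num)

lemma σ_rpow_le (n : ℕ) : P.σ n ^ P.K ≤ P.σ n := by
  conv_rhs => rw [← Real.rpow_one (P.σ n)]
  exact Real.rpow_le_rpow_of_exponent_ge (P.σ_pos n) (P.σ_lt_one n).le P.one_le_K

lemma σ_rpow_pos (n : ℕ) : 0 < P.σ n ^ P.K := Real.rpow_pos_of_pos (P.σ_pos n) _

lemma k_pos' (n : ℕ) : 0 < (P.k n : ℝ) := by exact_mod_cast P.k_pos n

lemma one_le_k (n : ℕ) : 1 ≤ (P.k n : ℝ) := by exact_mod_cast P.k_pos n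

lemma R_pos (n : ℕ) : 0 < P.R n := by
  have := P.k_pos' n
  unfold R; positivity

lemma two_mul_R (n : ℕ) : 2 * P.R n = 1 / P.k n := by
  have := P.k_pos' n
  unfold R; field_simp

lemma R_le (n : ℕ) : P.R n ≤ 1 / 2 := by
  have h1 := P.two_mul_R n
  have h2 : 1 / (P.k n : ℝ) ≤ 1 := by
    rw [div_le_one (P.k_pos' n)]; exact P.one_le_k n
  linarith

/-- A sequence of radii which is admissible for the nested families of disks. -/
structure IsScale (a : ℕ → ℝ) : Prop where
  zero : a 0 = 1
  pos : ∀ n, 0 < a n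
  succ_le : ∀ n, a (n + 1) ≤ a n * (P.R n / 2)

lemma s_pos (n : ℕ) : 0 < P.s n := by
  induction n with
  | zero => exact one_pos
  | succ n ih => exact mul_pos ih (mul_pos (P.R_pos n) (P.σ_rpow_pos n))

lemma t_pos (n : ℕ) : 0 < P.t n := by
  induction n with
  | zero => exact one_pos
  | succ n ih => exact mul_pos ih (mul_pos (P.R_pos n) (P.σ_pos n))

lemma isScale_s : P.IsScale P.s where
  zero := rfl
  pos := P.s_pos
  succ_le n := by
    have h1 := P.s_pos n
    have h2 := P.R_pos n
    have h3 := (P.σ_rpow_le n).trans (P.σ_le n)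
    change P.s n * (P.R n * P.σ n ^ P.K) ≤ _
    gcongr
    nlinarith

lemma isScale_t : P.IsScale P.t where
  zero := rfl
  pos := P.t_pos
  succ_le n := by
    have h1 := P.t_pos n
    have h2 := P.R_pos n
    have h3 := P.σ_le n
    change P.t n * (P.R n * P.σ n) ≤ _
    gcongr
    nlinarith

lemma s_le_t (n : ℕ) : P.s n ≤ P.t n := by
  induction n with
  | zero => exact le_rfl
  | succ n ih =>
    have h1 := P.R_pos n
    have h2 := P.σ_rpow_le n
    have h3 := P.σ_rpow_pos n
    have h4 := P.t_pos n
    change P.s n * (P.R n * P.σ n ^ P.K) ≤ P.t n * (P.R n * P.σ n)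
    gcongr

variable {P}

lemma IsScale.succ_le_div {a : ℕ → ℝ} (ha : P.IsScale a) (n : ℕ) : a (n + 1) ≤ a n / 4 := by
  have h1 := ha.succ_le n
  have h2 := P.R_le n
  have h3 := ha.pos n
  nlinarith

lemma IsScale.antitone {a : ℕ → ℝ} (ha : P.IsScale a) : Antitone a :=
  antitone_nat_of_succ_le fun n => by linarith [ha.succ_le_div n, ha.pos n]

lemma IsScale.le_pow {a : ℕ → ℝ} (ha : P.IsScale a) (n : ℕ) : a n ≤ (1 / 2) ^ n := by
  induction n with
  | zero => simp [ha.zero]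
  | succ n ih =>
    have h1 := ha.succ_le_div n
    have h2 := ha.pos n
    rw [pow_succ]
    linarith

lemma IsScale.tendsto_zero {a : ℕ → ℝ} (ha : P.IsScale a) : Tendsto a atTop (𝓝 0) :=
  squeeze_zero (fun n => (ha.pos n).le) ha.le_pow
    (tendsto_pow_atTop_nhds_zero_of_lt_one (by norm_num) (by norm_num))

variable (P)

lemma mem_Z_succ {n : ℕ} {c : ℂ} :
    c ∈ P.Z (n + 1) ↔ ∃ z ∈ P.Z n, ∃ p, z + P.s n • gridPoint (P.k n) p = c := by
  simp [Z, Finset.mem_image₂]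

lemma norm_gridPoint_le' (n : ℕ) (p : Fin (P.k n) × Fin (P.k n)) :
    ‖gridPoint (P.k n) p‖ ≤ 1 - 2 * P.R n := by
  rw [two_mul_R]; exact norm_gridPoint_le p

lemma norm_sub_le_of_child {n : ℕ} {z x : ℂ} (p : Fin (P.k n) × Fin (P.k n))
    (hx : ‖x - (z + P.s n • gridPoint (P.k n) p)‖ ≤ P.s n * P.R n) : ‖x - z‖ ≤ P.s n := by
  have h1 : x - z = (x - (z + P.s n • gridPoint (P.k n) p)) + P.s n • gridPoint (P.k n) p := by
    ring
  have h2 := norm_add_le (x - (z + P.s n • gridPoint (P.k n) p)) (P.s n • gridPoint (P.k n) p)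
  rw [← h1, norm_smul, Real.norm_of_nonneg (P.s_pos n).le] at h2
  have h3 := mul_le_mul_of_nonneg_left (P.norm_gridPoint_le' n p) (P.s_pos n).le
  have h4 := mul_pos (P.s_pos n) (P.R_pos n)
  linarith

/-- Children of one parent are separated by the grid. Those of different parents are separated
because the parents are `4 * P.s n` apart and each child is within `P.s n` of its parent. -/
lemma isPacking_succ {n : ℕ} (h : IsPacking (P.Z n) (2 * P.s n)) :
    IsPacking (P.Z (n + 1)) (P.s n * P.R n) := by
  intro c hc c' hc' hne
  obtain ⟨z, hz, p, rfl⟩ := P.mem_Z_succ.1 hc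
  obtain ⟨z', hz', p', rfl⟩ := P.mem_Z_succ.1 hc'
  have hs := P.s_pos n
  by_cases hzz : z = z'
  · subst hzz
    have hp : p ≠ p' := fun h => hne (by rw [h])
    rw [add_sub_add_left_eq_sub, ← smul_sub, norm_smul, Real.norm_of_nonneg hs.le,
      mul_left_comm, two_mul_R]
    gcongr
    exact le_norm_gridPoint_sub hp
  · have h1 := h z hz z' hz' hzz
    have h2 : ‖z - z'‖ ≤ ‖z + P.s n • gridPoint (P.k n) p - (z' + P.s n • gridPoint (P.k n) p')‖
        + ‖P.s n • gridPoint (P.k n) p'‖ + ‖P.s n • gridPoint (P.k n) p‖ := by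
      generalize P.s n • gridPoint (P.k n) p = a
      generalize P.s n • gridPoint (P.k n) p' = b
      have e1 : z - z' = (z + a - (z' + b)) + b - a := by ring
      rw [e1]
      exact (norm_sub_le _ _).trans (add_le_add_left (norm_add_le _ _) _)
    rw [norm_smul, norm_smul, Real.norm_of_nonneg hs.le] at h2
    have h3 := mul_le_mul_of_nonneg_left (P.norm_gridPoint_le' n p) hs.le
    have h4 := mul_le_mul_of_nonneg_left (P.norm_gridPoint_le' n p') hs.le
    have h5 := P.R_pos n
    nlinarith

/-- The extra factor `2` comes from `σ n ^ K ≤ 1 / 2`. It leaves gaps between the disks of a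
generation, so that a point lies in at most one of them. -/
lemma isPacking_Z (n : ℕ) : IsPacking (P.Z n) (2 * P.s n) := by
  induction n with
  | zero =>
    intro c hc c' hc' hne
    simp only [Z, Finset.mem_singleton] at hc hc'
    exact absurd (hc.trans hc'.symm) hne
  | succ n ih =>
    intro c hc c' hc' hne
    have h1 := P.isPacking_succ ih c hc c' hc' hne
    have h2 := P.isScale_s.succ_le n
    linarith

lemma isPacking_Z_succ (n : ℕ) : IsPacking (P.Z (n + 1)) (P.s n * P.R n) :=
  P.isPacking_succ (P.isPacking_Z n)

/-- The radial stretching used in step `n`. -/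
noncomputable def stretch (n : ℕ) : ℂ ≃ₜ ℂ :=
  radialStretch P.K (P.σ n) P.one_le_K (P.σ_pos n) (P.σ_lt_one n).le

lemma stretch_of_one_le (n : ℕ) (w : ℂ) (hw : 1 ≤ ‖w‖) : P.stretch n w = w :=
  radialStretch_of_one_le _ _ _ hw

lemma ρ_pos (n : ℕ) : 0 < P.s n * P.R n := mul_pos (P.s_pos n) (P.R_pos n)

/-- The homeomorphism which stretches the disks of the `n`-th packing. -/
noncomputable def S (n : ℕ) : ℂ ≃ₜ ℂ :=
  spreadHomeo (P.Z (n + 1)) (P.s n * P.R n) (P.stretch n) (P.ρ_pos n) (P.isPacking_Z_succ n)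
    (P.stretch_of_one_le n)

lemma S_apply (n : ℕ) (x : ℂ) :
    P.S n x = spreadMap (P.Z (n + 1)) (P.s n * P.R n) (P.stretch n) x := rfl

/-- The approximating homeomorphisms. -/
noncomputable def φ : ℕ → ℂ ≃ₜ ℂ
  | 0 => Homeomorph.refl ℂ
  | n + 1 => (P.S n).trans (φ n)

lemma φ_succ (n : ℕ) (x : ℂ) : P.φ (n + 1) x = P.φ n (P.S n x) := rfl

lemma mem_D {n : ℕ} {x : ℂ} : x ∈ P.D n ↔ ∃ z ∈ P.Z n, ‖x - z‖ ≤ P.s n := by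
  simp [D, dist_eq_norm]

lemma S_eq_self_or (n : ℕ) (x : ℂ) :
    P.S n x = x ∨ ∃ z ∈ P.Z n, ‖x - z‖ ≤ P.s n ∧ ‖P.S n x - z‖ ≤ P.s n := by
  by_cases h : ∃ c ∈ P.Z (n + 1), ‖x - c‖ ≤ P.s n * P.R n
  · right
    obtain ⟨c, hc, hx⟩ := h
    have h1 := norm_spreadMap_sub_le (P.ρ_pos n) (P.isPacking_Z_succ n) (P.stretch_of_one_le n)
      (fun _ => (P.stretch n).norm_le_one_of_eq_self (P.stretch_of_one_le n)) hc hx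
    obtain ⟨z, hz, p, rfl⟩ := P.mem_Z_succ.1 hc
    exact ⟨z, hz, P.norm_sub_le_of_child p hx, P.norm_sub_le_of_child p h1⟩
  · left
    push Not at h
    exact spreadMap_of_forall_le (P.ρ_pos n) (P.stretch_of_one_le n) fun c hc => (h c hc).le

lemma S_of_notMem {n : ℕ} {x : ℂ} (hx : x ∉ P.D n) : P.S n x = x := by
  refine (P.S_eq_self_or n x).resolve_right ?_
  rintro ⟨z, hz, h, -⟩
  exact hx (P.mem_D.2 ⟨z, hz, h⟩)

lemma eq_of_norm_sub_le {n : ℕ} {x z z' : ℂ} (hz : z ∈ P.Z n) (hz' : z' ∈ P.Z n)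
    (h : ‖x - z‖ ≤ P.s n) (h' : ‖x - z'‖ ≤ P.s n) : z = z' := by
  by_contra hne
  have h1 := P.isPacking_Z n z hz z' hz' hne
  have h2 : ‖z - z'‖ ≤ ‖x - z'‖ + ‖x - z‖ := by
    have := norm_sub_le (x - z') (x - z)
    rwa [sub_sub_sub_cancel_left] at this
  linarith [P.s_pos n]

lemma norm_S_sub_le {n : ℕ} {x z : ℂ} (hz : z ∈ P.Z n) (hx : ‖x - z‖ ≤ P.s n) :
    ‖P.S n x - z‖ ≤ P.s n := by
  rcases P.S_eq_self_or n x with h | ⟨z', hz', h, h'⟩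
  · rwa [h]
  · rwa [P.eq_of_norm_sub_le hz hz' hx h]

lemma norm_S_sub_self_le (n : ℕ) (x : ℂ) : ‖P.S n x - x‖ ≤ 2 * P.s n := by
  rcases P.S_eq_self_or n x with h | ⟨z, hz, h, h'⟩
  · rw [h, sub_self, norm_zero]; linarith [P.s_pos n]
  · have := norm_sub_le (P.S n x - z) (x - z)
    rw [sub_sub_sub_cancel_right] at this
    linarith

lemma S_of_mem_Z {n : ℕ} {c : ℂ} (hc : c ∈ P.Z (n + 1)) {x : ℂ} (hx : ‖x - c‖ ≤ P.s (n + 1)) :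
    P.S n x = c + (P.σ n / P.σ n ^ P.K) • (x - c) := by
  have hρ := P.ρ_pos n
  have hs : P.s (n + 1) = (P.s n * P.R n) * P.σ n ^ P.K := by rw [mul_assoc]; rfl
  have h1 : P.σ n ^ P.K ≤ 1 := (P.σ_rpow_le n).trans (P.σ_lt_one n).le
  rw [S_apply, spreadMap_of_mem hρ (P.isPacking_Z_succ n) (P.stretch_of_one_le n) hc
    (hx.trans (by rw [hs]; exact mul_le_of_le_one_right hρ.le h1)), stretch,
    radialStretch_of_le]
  · rw [smul_comm (P.s n * P.R n), smul_inv_smul₀ hρ.ne']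
  · rw [norm_smul, norm_inv, Real.norm_of_nonneg hρ.le, inv_mul_le_iff₀ hρ]
    rwa [hs] at hx

/-- Both factors of `φ (n + 1) = φ n ∘ S n` are homotheties up to translation: `S n` on the core of
each stretched disk, `φ n` on the parent. This keeps the distortion from compounding. -/
lemma φ_of_mem_Z {n : ℕ} {z : ℂ} (hz : z ∈ P.Z n) {x : ℂ} (hx : ‖x - z‖ ≤ P.s n) :
    P.φ n x = P.φ n z + (P.t n / P.s n) • (x - z) := by
  induction n generalizing z x with
  | zero => simp [φ, t, s]
  | succ n ih =>
    obtain ⟨y, hy, p, hp⟩ := P.mem_Z_succ.1 hz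
    have hs := P.s_pos n
    have hzy : ‖z - y‖ ≤ P.s n :=
      P.norm_sub_le_of_child p (by rw [hp, sub_self, norm_zero]; exact (P.ρ_pos n).le)
    have hxy : ‖x - y‖ ≤ P.s n := by
      refine P.norm_sub_le_of_child p ?_
      rw [hp]
      have h1 := P.isScale_s.succ_le n
      have h2 := P.ρ_pos n
      linarith
    have hSz : P.S n z = z := by
      rw [P.S_of_mem_Z hz (by rw [sub_self, norm_zero]; exact (P.s_pos _).le)]; simp
    have hSx := P.norm_S_sub_le hy hxy
    have hr : P.t (n + 1) / P.s (n + 1) = P.t n / P.s n * (P.σ n / P.σ n ^ P.K) := by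
      have h1 := P.R_pos n
      have h2 := P.σ_rpow_pos n
      change P.t n * (P.R n * P.σ n) / (P.s n * (P.R n * P.σ n ^ P.K)) = _
      field_simp
    rw [φ_succ, φ_succ, hSz, ih hy hzy, ih hy hSx, P.S_of_mem_Z hz hx, hr, mul_smul]
    module

lemma φ_child {n : ℕ} {z : ℂ} (hz : z ∈ P.Z n) (p : Fin (P.k n) × Fin (P.k n)) :
    P.φ (n + 1) (z + P.s n • gridPoint (P.k n) p) = P.φ n z + P.t n • gridPoint (P.k n) p := by
  have hc : z + P.s n • gridPoint (P.k n) p ∈ P.Z (n + 1) := P.mem_Z_succ.2 ⟨z, hz, p, rfl⟩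
  rw [φ_succ, P.S_of_mem_Z hc (by rw [sub_self, norm_zero]; exact (P.s_pos _).le), sub_self,
    smul_zero, add_zero, P.φ_of_mem_Z hz, add_sub_cancel_left, smul_smul,
    div_mul_cancel₀ _ (P.s_pos n).ne']
  exact P.norm_sub_le_of_child p (by rw [sub_self, norm_zero]; exact (P.ρ_pos n).le)

lemma dist_φ_succ (n : ℕ) (x : ℂ) : dist (P.φ n x) (P.φ (n + 1) x) ≤ 2 * P.t n := by
  rw [φ_succ]
  have ht := P.t_pos n
  have hs := P.s_pos n
  rcases P.S_eq_self_or n x with h | ⟨z, hz, h, h'⟩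
  · rw [h, dist_self]; linarith
  · rw [P.φ_of_mem_Z hz h, P.φ_of_mem_Z hz h', dist_add_left, dist_smul₀, dist_eq_norm,
      Real.norm_of_nonneg (by positivity), norm_sub_rev]
    have h1 := norm_sub_le (P.S n x - z) (x - z)
    rw [sub_sub_sub_cancel_right] at h1
    rw [sub_sub_sub_cancel_right, div_mul_eq_mul_div, div_le_iff₀ hs]
    nlinarith

lemma dist_φ_symm_succ (n : ℕ) (x : ℂ) :
    dist ((P.φ n).symm x) ((P.φ (n + 1)).symm x) ≤ 2 * P.s n := by
  have h1 : (P.φ (n + 1)).symm x = (P.S n).symm ((P.φ n).symm x) := rfl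
  have h2 := P.norm_S_sub_self_le n ((P.S n).symm ((P.φ n).symm x))
  rwa [Homeomorph.apply_symm_apply, ← dist_eq_norm, ← h1] at h2

lemma D_succ_subset (n : ℕ) : P.D (n + 1) ⊆ P.D n := by
  intro x hx
  obtain ⟨c, hc, h⟩ := P.mem_D.1 hx
  obtain ⟨z, hz, p, rfl⟩ := P.mem_Z_succ.1 hc
  refine P.mem_D.2 ⟨z, hz, P.norm_sub_le_of_child p (h.trans ?_)⟩
  have h1 := P.isScale_s.succ_le n
  have h2 := P.ρ_pos n
  linarith

lemma antitone_D : Antitone P.D := antitone_nat_of_succ_le P.D_succ_subset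

lemma D_zero : P.D 0 = Metric.closedBall 0 1 := by simp [D, Z, s]

lemma isClosed_D (n : ℕ) : IsClosed (P.D n) :=
  (P.Z n).finite_toSet.isClosed_biUnion fun _ _ => Metric.isClosed_closedBall

lemma φ_eq_of_notMem {n m : ℕ} (hnm : n ≤ m) {x : ℂ} (hx : x ∉ P.D n) : P.φ m x = P.φ n x := by
  induction m, hnm using Nat.le_induction with
  | base => rfl
  | succ m hm ih => rw [φ_succ, P.S_of_notMem fun h => hx (P.antitone_D hm h), ih]

lemma exists_lipschitzWith_φ (n : ℕ) : ∃ C, LipschitzWith C (P.φ n) := by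
  induction n with
  | zero => exact ⟨1, LipschitzWith.id⟩
  | succ n ih =>
    obtain ⟨C, hC⟩ := ih
    obtain ⟨C', hC'⟩ := exists_lipschitzWith_spreadMap (P.Z (n + 1)) (P.s n * P.R n)
      (exists_lipschitzWith_radialStretch P.one_le_K (P.σ_pos n) (P.σ_lt_one n).le)
    exact ⟨_, hC.comp hC'⟩

/-- Inside a disk of generation `n` the new map is `S n` followed by a similarity. Off `D n` it
coincides locally with the old one, and the boundary circles are null. -/
lemma ae_hasDistortionAt_φ (n : ℕ) : ∀ᵐ z : ℂ, HasDistortionAt P.K (P.φ n) z := by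
  induction n with
  | zero => exact Eventually.of_forall fun z => hasDistortionAt_id P.one_le_K z
  | succ n ih =>
    have hsphere : ∀ᵐ x : ℂ, ∀ z ∈ P.Z n, ‖x - z‖ ≠ P.s n := by
      rw [Filter.eventually_all_finset]
      intro c _
      have : volume (Metric.sphere c (P.s n)) = 0 := Measure.addHaar_sphere _ _ _
      filter_upwards [measure_eq_zero_iff_ae_notMem.1 this] with z hz
      simpa [dist_eq_norm] using hz
    filter_upwards [ih, hsphere, ae_hasDistortionAt_spreadMap_radialStretch P.one_le_K
      (P.σ_pos n) (P.σ_lt_one n).le (P.ρ_pos n) (P.isPacking_Z_succ n)] with x h1 h2 h3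
    by_cases hx : x ∈ P.D n
    · obtain ⟨z, hz, hxz⟩ := P.mem_D.1 hx
      have hlt := lt_of_le_of_ne hxz (h2 z hz)
      refine (h3.const_add_smul (P.φ n z - (P.t n / P.s n) • z) (P.t n / P.s n)).congr ?_
      have ho : IsOpen {y : ℂ | ‖y - z‖ < P.s n} := isOpen_lt (by fun_prop) (by fun_prop)
      filter_upwards [ho.mem_nhds hlt] with y hy
      rw [φ_succ, P.φ_of_mem_Z hz (P.norm_S_sub_le hz (le_of_lt hy)), S_apply, stretch, smul_sub]
      ring
    · refine h1.congr ?_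
      filter_upwards [(P.isClosed_D n).isOpen_compl.mem_nhds hx] with y hy
      rw [φ_succ, P.S_of_notMem hy]

lemma exists_limit : ∃ f : ℂ ≃ₜ ℂ, TendstoUniformly (fun n => P.φ n) f atTop := by
  refine exists_homeomorph_tendstoUniformly (C := 2) (r := 1 / 2) (by norm_num)
    (fun n x => (P.dist_φ_succ n x).trans ?_) (fun n x => (P.dist_φ_symm_succ n x).trans ?_)
    (by norm_num)
  · gcongr; exact P.isScale_t.le_pow n
  · gcongr; exact P.isScale_s.le_pow n

/-- The limit homeomorphism. -/
noncomputable def Φ : ℂ ≃ₜ ℂ := P.exists_limit.choose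

lemma tendstoUniformly_φ : TendstoUniformly (fun n => P.φ n) P.Φ atTop :=
  P.exists_limit.choose_spec

lemma Φ_eq_of_notMem {n : ℕ} {x : ℂ} (hx : x ∉ P.D n) : P.Φ x = P.φ n x := by
  refine tendsto_nhds_unique (P.tendstoUniformly_φ.tendsto_at x) (tendsto_const_nhds.congr' ?_)
  filter_upwards [eventually_ge_atTop n] with m hm
  exact (P.φ_eq_of_notMem hm hx).symm

lemma image_D_subset {f : ℂ ≃ₜ ℂ} (hf : ∀ x ∉ P.D 0, f x = x) (n : ℕ) : f '' P.D n ⊆ P.D 0 := by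
  rintro _ ⟨x, hx, rfl⟩
  by_contra h
  have h1 := f.injective (hf _ h)
  rw [h1] at h
  exact h (P.antitone_D (Nat.zero_le n) hx)

lemma card_Z_le (n : ℕ) : (P.Z n).card ≤ P.N n := by
  induction n with
  | zero => simp [Z, N]
  | succ n ih =>
    rw [Z, N, Finset.prod_range_succ]
    refine (Finset.card_image₂_le _ _ _).trans ?_
    simp only [Finset.card_univ, Fintype.card_prod, Fintype.card_fin, ← sq]
    exact Nat.mul_le_mul_right _ ih

lemma N_succ (n : ℕ) : (P.N (n + 1) : ℝ) = P.N n * P.k n ^ 2 := by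
  simp [N, Finset.prod_range_succ]

/-- One step multiplies the quantity by `(k R)^2 = 1 / 4` times `σ ^ (2 K) ≤ 1`. -/
lemma N_mul_sq_le (n : ℕ) : P.N n * P.s n ^ 2 ≤ (1 / 2) ^ n := by
  induction n with
  | zero => simp [N, s]
  | succ n ih =>
    have h1 : (P.N (n + 1) : ℝ) * P.s (n + 1) ^ 2 =
        (P.N n * P.s n ^ 2) * (P.σ n ^ P.K) ^ 2 * ((P.k n * P.R n) ^ 2) := by
      rw [N_succ]
      change _ * (P.s n * (P.R n * P.σ n ^ P.K)) ^ 2 = _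
      ring
    have h2 : P.k n * P.R n = 1 / 2 := by
      have := P.k_pos' n
      unfold R; field_simp
    have h3 := (P.σ_rpow_le n).trans (P.σ_lt_one n).le
    have h4 := pow_le_one₀ (n := 2) (P.σ_rpow_pos n).le h3
    have h5 : 0 ≤ P.N n * P.s n ^ 2 := by positivity
    have h6 := mul_le_mul_of_nonneg_left h4 h5
    have h7 : (1 / 2 : ℝ) ^ (n + 1) = (1 / 2) ^ n * (1 / 2) := pow_succ _ _
    rw [h1, h2, h7]
    linarith

lemma volume_D_le (n : ℕ) : volume (P.D n) ≤ ENNReal.ofReal ((1 / 2) ^ n) * NNReal.pi := by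
  calc volume (P.D n) ≤ ∑ z ∈ P.Z n, volume (Metric.closedBall z (P.s n)) :=
        measure_biUnion_finset_le _ _
    _ = (P.Z n).card * (ENNReal.ofReal (P.s n) ^ 2 * NNReal.pi) := by simp
    _ ≤ P.N n * (ENNReal.ofReal (P.s n) ^ 2 * NNReal.pi) := by
        gcongr
        exact P.card_Z_le n
    _ = ENNReal.ofReal (P.N n * P.s n ^ 2) * NNReal.pi := by
        rw [← mul_assoc, ENNReal.ofReal_mul (by positivity), ENNReal.ofReal_natCast,
          ENNReal.ofReal_pow (P.s_pos n).le]
    _ ≤ _ := by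
        gcongr
        exact P.N_mul_sq_le n

lemma tendsto_volume_D : Tendsto (fun n => volume (P.D n)) atTop (𝓝 0) := by
  refine tendsto_of_tendsto_of_tendsto_of_le_of_le tendsto_const_nhds ?_ (fun _ => zero_le)
    P.volume_D_le
  have h1 := ENNReal.tendsto_ofReal
    (tendsto_pow_atTop_nhds_zero_of_lt_one (r := (1 / 2 : ℝ)) (by norm_num) (by norm_num))
  simpa using ENNReal.Tendsto.mul_const h1 (Or.inr ENNReal.coe_ne_top)

/-- Almost every point leaves some closed `D n`, and near such a point the limit equals `φ n`. -/
lemma ae_hasDistortionAt_Φ : ∀ᵐ z : ℂ, HasDistortionAt P.K P.Φ z := by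
  have h0 : volume (⋂ n, P.D n) = 0 := by
    refine le_antisymm (ge_of_tendsto' P.tendsto_volume_D fun n => ?_) zero_le
    exact measure_mono (Set.iInter_subset _ n)
  filter_upwards [ae_all_iff.2 P.ae_hasDistortionAt_φ, measure_eq_zero_iff_ae_notMem.1 h0]
    with x h1 h2
  obtain ⟨n, hn⟩ := by simpa using h2
  refine (h1 n).congr ?_
  filter_upwards [(P.isClosed_D n).isOpen_compl.mem_nhds hn] with y hy
  exact P.Φ_eq_of_notMem hy

/-- The limit homeomorphism is quasiconformal. -/
theorem isQuasiconformal_Φ : IsQuasiconformal P.K P.Φ := by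
  have hK : 0 ≤ P.K := zero_le_one.trans P.one_le_K
  have hφ : ∀ n, ∀ x ∉ P.D 0, P.φ n x = x := fun n x hx => P.φ_eq_of_notMem (Nat.zero_le n) hx
  have hΦ : ∀ x ∉ P.D 0, P.Φ x = x := fun x hx => P.Φ_eq_of_notMem hx
  refine ⟨orientationPreserving_of_eq_self (M := 2) zero_le_two fun z hz => hΦ z ?_,
    fderiv ℝ P.Φ, ?_, ?_⟩
  · rw [D_zero, mem_closedBall_zero_iff]; linarith
  · exact hasSobolevDeriv_of_tendstoUniformly hK P.exists_lipschitzWith_φ P.ae_hasDistortionAt_φ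
      P.ae_hasDistortionAt_Φ P.isClosed_D P.tendsto_volume_D (fun n z => P.Φ_eq_of_notMem)
      P.tendstoUniformly_φ (B := P.D 0) (by rw [D_zero]; exact isCompact_closedBall _ _)
      (fun n => P.image_D_subset (hφ n) n) (P.image_D_subset hΦ)
  · filter_upwards [P.ae_hasDistortionAt_Φ] with z ⟨D, hD, hK⟩ α β
    rw [hD.fderiv]
    exact hK.norm_le _ _ (by simp only [Complex.norm_exp_ofReal_mul_I])

end CantorData

/-! ### Digits and the natural measure on the image -/

lemma card_filter_abs_sub_le {k : ℕ} (i₀ : Fin k) {X : ℝ} (hX : 0 ≤ X) :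
    ((Finset.univ.filter fun i : Fin k => |(i : ℝ) - i₀| ≤ X).card : ℝ) ≤ 2 * X + 1 := by
  set a : ℤ := ⌈(i₀ : ℝ) - X⌉
  set b : ℤ := ⌊(i₀ : ℝ) + X⌋
  have h1 : (Finset.univ.filter fun i : Fin k => |(i : ℝ) - i₀| ≤ X).card ≤
      (Finset.Icc a b).card := by
    refine Finset.card_le_card_of_injOn (fun i => ((i : ℕ) : ℤ)) (fun i hi => ?_)
      fun i _ j _ hij => Fin.ext (Int.ofNat_inj.1 hij)
    have hi' := abs_le.1 (Finset.mem_filter.1 hi).2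
    simp only [Finset.coe_Icc, Set.mem_Icc, a, b]
    refine ⟨Int.ceil_le.2 ?_, Int.le_floor.2 ?_⟩ <;> push_cast <;> linarith
  have h2 : ((Finset.Icc a b).card : ℝ) ≤ 2 * X + 1 := by
    rw [Int.card_Icc]
    have h3 : (((b + 1 - a).toNat : ℤ) : ℝ) = max ((b : ℝ) + 1 - a) 0 := by
      rw [Int.toNat_eq_max]; push_cast; rfl
    rw [Int.cast_natCast] at h3
    rw [h3]
    have h4 : (b : ℝ) ≤ i₀ + X := Int.floor_le _
    have h5 : (i₀ : ℝ) - X ≤ a := Int.le_ceil _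
    exact max_le (by linarith) (by linarith)
  exact le_trans (by exact_mod_cast h1) h2

namespace CantorData
variable (P : CantorData)

/-- The sequences of digits which encode the points of the Cantor sets. -/
abbrev Digits : Type := ∀ n, Fin (P.k n) × Fin (P.k n)

variable {P} {a : ℕ → ℝ}

/-- The centre of the `n`-th disk with digits `ξ`, for the radii `a`. -/
noncomputable def partialPoint (a : ℕ → ℝ) (ξ : P.Digits) (n : ℕ) : ℂ :=
  ∑ j ∈ Finset.range n, a j • gridPoint (P.k j) (ξ j)

/-- The point with digits `ξ`, for the radii `a`. -/
noncomputable def limitPoint (a : ℕ → ℝ) (ξ : P.Digits) : ℂ :=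
  limUnder atTop (partialPoint a ξ)

lemma partialPoint_succ (ξ : P.Digits) (n : ℕ) :
    partialPoint a ξ (n + 1) = partialPoint a ξ n + a n • gridPoint (P.k n) (ξ n) :=
  Finset.sum_range_succ _ _

lemma IsScale.dist_partialPoint_le (ha : P.IsScale a) (ξ : P.Digits) {n m : ℕ} (h : n ≤ m) :
    dist (partialPoint a ξ n) (partialPoint a ξ m) ≤ a n - a m := by
  induction m, h using Nat.le_induction with
  | base => simp
  | succ m hm ih =>
    refine (dist_triangle _ (partialPoint a ξ m) _).trans ?_
    have h1 : dist (partialPoint a ξ m) (partialPoint a ξ (m + 1)) ≤ a m - a (m + 1) := by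
      rw [partialPoint_succ, dist_self_add_right, norm_smul, Real.norm_of_nonneg (ha.pos m).le]
      have h2 := mul_le_mul_of_nonneg_left (P.norm_gridPoint_le' m (ξ m)) (ha.pos m).le
      have h3 := ha.succ_le m
      have h4 := mul_pos (ha.pos m) (P.R_pos m)
      linarith
    linarith

lemma IsScale.tendsto_partialPoint (ha : P.IsScale a) (ξ : P.Digits) :
    Tendsto (partialPoint a ξ) atTop (𝓝 (limitPoint a ξ)) :=
  CauchySeq.tendsto_limUnder <| cauchySeq_of_le_tendsto_0' a
    (fun n m h => (ha.dist_partialPoint_le ξ h).trans (by linarith [ha.pos m])) ha.tendsto_zero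

lemma IsScale.dist_limitPoint_le (ha : P.IsScale a) (ξ : P.Digits) (n : ℕ) :
    dist (partialPoint a ξ n) (limitPoint a ξ) ≤ a n := by
  refine le_of_tendsto (tendsto_const_nhds.dist (ha.tendsto_partialPoint ξ)) ?_
  filter_upwards [eventually_ge_atTop n] with m hm
  exact (ha.dist_partialPoint_le ξ hm).trans (by linarith [ha.pos m])

/-- The centres of order `m` coincide, those of order `m + 1` differ only by the grid term, and each
limit point is within `a (m + 1)` of its centre. -/
lemma IsScale.mul_norm_gridPoint_sub_le (ha : P.IsScale a) {ξ ξ' : P.Digits} {m : ℕ}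
    (h : ∀ j < m, ξ j = ξ' j) :
    a m * ‖gridPoint (P.k m) (ξ m) - gridPoint (P.k m) (ξ' m)‖ ≤
      dist (limitPoint a ξ) (limitPoint a ξ') + 2 * a (m + 1) := by
  have h1 : partialPoint a ξ m = partialPoint a ξ' m :=
    Finset.sum_congr rfl fun j hj => by rw [h j (Finset.mem_range.1 hj)]
  have h2 : a m * ‖gridPoint (P.k m) (ξ m) - gridPoint (P.k m) (ξ' m)‖ =
      dist (partialPoint a ξ (m + 1)) (partialPoint a ξ' (m + 1)) := by
    rw [partialPoint_succ, partialPoint_succ, h1, dist_add_left, dist_smul₀, dist_eq_norm,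
      Real.norm_of_nonneg (ha.pos m).le]
  rw [h2]
  have h3 := ha.dist_limitPoint_le ξ (m + 1)
  have h4 := ha.dist_limitPoint_le ξ' (m + 1)
  have h5 := dist_triangle4_right (partialPoint a ξ (m + 1)) (partialPoint a ξ' (m + 1))
    (limitPoint a ξ) (limitPoint a ξ')
  linarith

/-- At a first differing digit `j < n` the grid term is at least `2 * a j * R j ≥ 4 * a (j + 1)`, so
the limit points would be at least `2 * a (j + 1) > a n` apart. -/
lemma IsScale.digits_eq (ha : P.IsScale a) {ξ ξ' : P.Digits} {n : ℕ}
    (h : dist (limitPoint a ξ) (limitPoint a ξ') < a n) : ∀ j < n, ξ j = ξ' j := by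
  intro j
  induction j using Nat.strong_induction_on with
  | _ j ih =>
    intro hj
    by_contra hne
    have h1 := ha.mul_norm_gridPoint_sub_le fun i hi => ih i hi (hi.trans hj)
    have h2 := mul_le_mul_of_nonneg_left (le_norm_gridPoint_sub hne) (ha.pos j).le
    rw [← P.two_mul_R] at h2
    have h3 := ha.succ_le j
    have h4 : a n ≤ a (j + 1) := ha.antitone hj
    linarith [ha.pos (j + 1)]

variable (P)

lemma φ_partialPoint (ξ : P.Digits) (n : ℕ) : partialPoint P.s ξ n ∈ P.Z n ∧
    P.φ n (partialPoint P.s ξ n) = partialPoint P.t ξ n := by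
  induction n with
  | zero => simp [partialPoint, Z, φ]
  | succ n ih =>
    rw [partialPoint_succ, partialPoint_succ, P.φ_child ih.1, ih.2]
    exact ⟨P.mem_Z_succ.2 ⟨_, ih.1, _, rfl⟩, rfl⟩

lemma Φ_limitPoint (ξ : P.Digits) : P.Φ (limitPoint P.s ξ) = limitPoint P.t ξ := by
  have h1 := P.tendstoUniformly_φ.tendsto_comp P.Φ.continuous.continuousAt
    (P.isScale_s.tendsto_partialPoint ξ)
  simp only [(P.φ_partialPoint ξ _).2] at h1
  exact tendsto_nhds_unique h1 (P.isScale_t.tendsto_partialPoint ξ)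

/-- The Cantor set in the domain. -/
def E : Set ℂ := ⋂ n, P.D n

lemma isCompact_E : IsCompact P.E := by
  refine (isCompact_closedBall (0 : ℂ) 1).of_isClosed_subset (isClosed_iInter P.isClosed_D) ?_
  rw [← P.D_zero]
  exact Set.iInter_subset _ 0

lemma limitPoint_mem_image (ξ : P.Digits) : limitPoint P.t ξ ∈ P.Φ '' P.E := by
  refine ⟨_, Set.mem_iInter.2 fun n => ?_, P.Φ_limitPoint ξ⟩
  refine P.mem_D.2 ⟨_, (P.φ_partialPoint ξ n).1, ?_⟩
  rw [norm_sub_rev, ← dist_eq_norm]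
  exact P.isScale_s.dist_limitPoint_le ξ n

/-- The uniform measure on the `n`-th digits. -/
noncomputable def digitMeasure (n : ℕ) : Measure (Fin (P.k n) × Fin (P.k n)) :=
  ProbabilityTheory.uniformOn Set.univ

instance (n : ℕ) : IsProbabilityMeasure (P.digitMeasure n) :=
  have : Nonempty (Fin (P.k n) × Fin (P.k n)) := ⟨(⟨0, P.k_pos n⟩, ⟨0, P.k_pos n⟩)⟩
  ProbabilityTheory.isProbabilityMeasure_uniformOn Set.finite_univ Set.univ_nonempty

lemma digitMeasure_apply (n : ℕ) (s : Finset (Fin (P.k n) × Fin (P.k n))) :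
    P.digitMeasure n s = ENNReal.ofReal (s.card / P.k n ^ 2) := by
  have h := P.k_pos' n
  rw [digitMeasure, ProbabilityTheory.uniformOn_univ, Measure.count_apply_finset,
    ENNReal.ofReal_div_of_pos (by positivity), ENNReal.ofReal_natCast,
    ENNReal.ofReal_pow h.le, ENNReal.ofReal_natCast]
  simp [sq]

lemma measurable_limitPoint : Measurable (limitPoint P.t : P.Digits → ℂ) := by
  refine measurable_of_tendsto_metrizable (f := fun n ξ => partialPoint P.t ξ n) (fun n => ?_)
    (tendsto_pi_nhds.2 P.isScale_t.tendsto_partialPoint)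
  refine Finset.measurable_sum _ fun j _ => ?_
  exact ((Measurable.of_discrete (f := gridPoint (P.k j))).comp
    (measurable_pi_apply j)).const_smul (P.t j)

/-- The natural probability measure on the Cantor set in the target. -/
noncomputable def μ : Measure ℂ := (Measure.infinitePi P.digitMeasure).map (limitPoint P.t)

instance : IsProbabilityMeasure P.μ :=
  Measure.isProbabilityMeasure_map P.measurable_limitPoint.aemeasurable

lemma one_le_μ_image : 1 ≤ P.μ (P.Φ '' P.E) := by
  have hm : MeasurableSet (P.Φ '' P.E) :=
    (P.isCompact_E.image P.Φ.continuous).isClosed.measurableSet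
  have h1 : limitPoint P.t ⁻¹' (P.Φ '' P.E) = Set.univ :=
    Set.eq_univ_of_forall P.limitPoint_mem_image
  rw [μ, Measure.map_apply P.measurable_limitPoint hm, h1, measure_univ]

/-- The first `n` digits of points of `A` are forced, and digit `n` lies in a box of at most `(2 X +
1)^2` grid positions. Each choice has mass `1 / N (n + 1)`. -/
lemma μ_le_of_isClosed {A : Set ℂ} (hA : IsClosed A) {r : ℝ} {n : ℕ} (hr : P.t (n + 1) ≤ r)
    (hrn : r < P.t n) (hAr : ∀ x ∈ A, ∀ y ∈ A, dist x y ≤ r) :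
    P.μ A ≤ ENNReal.ofReal ((2 * (P.k n * (3 * r / P.t n)) + 1) ^ 2 / P.N (n + 1)) := by
  rw [μ, Measure.map_apply P.measurable_limitPoint hA.measurableSet]
  rcases Set.eq_empty_or_nonempty (limitPoint P.t ⁻¹' A) with h | ⟨ξ₀, h₀⟩
  · rw [h, measure_empty]; exact zero_le
  have htn := P.t_pos n
  have hr0 : 0 ≤ r := (P.t_pos (n + 1)).le.trans hr
  have hkn := P.k_pos' n
  -- The constant `3` comes from `r + 2 * t (n + 1) ≤ 3 * r`.
  set X : ℝ := P.k n * (3 * r / P.t n) with hX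
  have hX0 : 0 ≤ X := by positivity
  set T : ∀ j, Finset (Fin (P.k j) × Fin (P.k j)) := fun j =>
    if j < n then {ξ₀ j} else Finset.univ.filter (fun i : Fin (P.k j) => |(i : ℝ) - (ξ₀ j).1| ≤ X) ×ˢ
      Finset.univ.filter (fun i : Fin (P.k j) => |(i : ℝ) - (ξ₀ j).2| ≤ X) with hT
  have hsub : limitPoint P.t ⁻¹' A ⊆
      Set.pi (Finset.range (n + 1) : Finset ℕ) fun j => (T j : Set (Fin (P.k j) × Fin (P.k j))) := by
    intro ξ hξ
    have hd := hAr _ hξ _ h₀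
    have hdig := P.isScale_t.digits_eq (hd.trans_lt hrn)
    intro j hj
    rw [Finset.coe_range, Set.mem_Iio, Nat.lt_succ_iff] at hj
    rcases hj.lt_or_eq with hj | rfl
    · simp [hT, hj, hdig j hj]
    · have h1 := P.isScale_t.mul_norm_gridPoint_sub_le hdig
      have h2 : ‖gridPoint (P.k j) (ξ j) - gridPoint (P.k j) (ξ₀ j)‖ ≤ 3 * r / P.t j := by
        rw [le_div_iff₀ htn, mul_comm]; linarith
      have h3 := mul_le_mul_of_nonneg_left h2 hkn.le
      simp only [hT, lt_irrefl, if_false, Finset.mem_coe, Finset.mem_product, Finset.mem_filter,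
        Finset.mem_univ, true_and]
      exact ⟨(abs_fst_sub_le _ _).trans h3, (abs_snd_sub_le _ _).trans h3⟩
  refine (measure_mono hsub).trans ?_
  rw [Measure.infinitePi_pi _ fun j _ => (T j).measurableSet]
  simp only [digitMeasure_apply]
  rw [← ENNReal.ofReal_prod_of_nonneg fun j _ => by positivity]
  refine ENNReal.ofReal_le_ofReal ?_
  rw [Finset.prod_div_distrib, N, Nat.cast_prod]
  push_cast
  gcongr
  · rw [Finset.prod_range_succ, Finset.prod_eq_one, one_mul]
    · simp only [hT, lt_irrefl, if_false, Finset.card_product, Nat.cast_mul, sq]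
      gcongr
      · exact card_filter_abs_sub_le _ hX0
      · exact card_filter_abs_sub_le _ hX0
    · intro j hj
      simp [hT, Finset.mem_range.1 hj]

lemma μ_le_of_forall_dist_le {A : Set ℂ} {r : ℝ} {n : ℕ} (hr : P.t (n + 1) ≤ r)
    (hrn : r < P.t n) (hAr : ∀ x ∈ A, ∀ y ∈ A, dist x y ≤ r) {d b : ℝ} (hd : d ≤ 2)
    (hd0 : 0 < d) (hb : 0 < b) (hN : ∀ n, P.N n * P.t n ^ d = b ^ n) :
    P.μ A ≤ ENNReal.ofReal (r ^ d * (72 / b ^ n + 2 / b ^ (n + 1))) := by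
  have hcl : ∀ x ∈ closure A, ∀ y ∈ closure A, dist x y ≤ r := by
    intro x hx y hy
    exact closure_minimal (t := {p : ℂ × ℂ | dist p.1 p.2 ≤ r}) (s := A ×ˢ A)
      (fun p hp => hAr _ hp.1 _ hp.2) (isClosed_le continuous_dist continuous_const)
      (by rw [closure_prod_eq]; exact ⟨hx, hy⟩ : (x, y) ∈ closure (A ×ˢ A))
  refine (measure_mono subset_closure).trans
    ((P.μ_le_of_isClosed isClosed_closure hr hrn hcl).trans (ENNReal.ofReal_le_ofReal ?_))
  have ht := P.t_pos n
  have ht' := P.t_pos (n + 1)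
  have hr0 : 0 < r := ht'.trans_le hr
  have hk := P.k_pos' n
  have hbn : 0 < b ^ n := by positivity
  have hbn' : 0 < b ^ (n + 1) := by positivity
  have htd : 0 < P.t n ^ d := Real.rpow_pos_of_pos ht d
  have htd' : 0 < P.t (n + 1) ^ d := Real.rpow_pos_of_pos ht' d
  have hN0 : (P.N n : ℝ) = b ^ n / P.t n ^ d := by rw [eq_div_iff htd.ne', hN]
  have hN1 : (P.N (n + 1) : ℝ) = b ^ (n + 1) / P.t (n + 1) ^ d := by
    rw [eq_div_iff htd'.ne', hN]
  have hNpos : 0 < (P.N (n + 1) : ℝ) := by rw [hN1]; positivity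
  -- From `(x + 1)^2 ≤ 2 x^2 + 2` with `x = 6 k r / t`. The first term matters for `r` near `t n`,
  -- the second for `r` near `t (n + 1)`.
  have h1 : (2 * (P.k n * (3 * r / P.t n)) + 1) ^ 2 ≤
      72 * (r / P.t n) ^ 2 * P.k n ^ 2 + 2 := by
    have := sq_nonneg (2 * (P.k n * (3 * r / P.t n)) - 1)
    have h2 : (2 * (P.k n * (3 * r / P.t n))) ^ 2 = 36 * (r / P.t n) ^ 2 * P.k n ^ 2 := by ring
    nlinarith
  calc (2 * (P.k n * (3 * r / P.t n)) + 1) ^ 2 / P.N (n + 1)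
      ≤ (72 * (r / P.t n) ^ 2 * P.k n ^ 2 + 2) / P.N (n + 1) := by gcongr
    _ = 72 * (r / P.t n) ^ 2 / P.N n + 2 / P.N (n + 1) := by
        have hNn : (P.N n : ℝ) ≠ 0 := by rw [hN0]; positivity
        rw [N_succ]
        field_simp
    _ ≤ 72 * (r / P.t n) ^ d / P.N n + 2 / P.N (n + 1) := by
        have h2 : (r / P.t n) ^ 2 ≤ (r / P.t n) ^ d := by
          rw [← Real.rpow_natCast]
          refine Real.rpow_le_rpow_of_exponent_ge (by positivity) ?_ (by simpa using hd)
          rw [div_le_one ht]; exact hrn.le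
        gcongr
    _ = r ^ d * (72 / b ^ n) + P.t (n + 1) ^ d * (2 / b ^ (n + 1)) := by
        rw [hN0, hN1, Real.div_rpow hr0.le ht.le]
        field_simp
    _ ≤ r ^ d * (72 / b ^ n) + r ^ d * (2 / b ^ (n + 1)) := by
        have : P.t (n + 1) ^ d ≤ r ^ d := Real.rpow_le_rpow ht'.le hr hd0.le
        gcongr
    _ = _ := by ring

/-! ### Estimates of Hausdorff measures and the choice of parameters -/

lemma mkMetric_E_eq_zero {m : ENNReal → ENNReal} {B : ℕ → ℝ}
    (hm : ∀ n, ∀ x ≤ ENNReal.ofReal (2 * P.s n), m x ≤ ENNReal.ofReal (B n))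
    (hB : Tendsto (fun n => P.N n * B n) atTop (𝓝 0)) : Measure.mkMetric m P.E = 0 := by
  refine le_antisymm ?_ zero_le
  have hdiam : ∀ (n : ℕ) (z : P.Z n),
      Metric.ediam (Metric.closedBall (z : ℂ) (P.s n)) ≤ ENNReal.ofReal (2 * P.s n) := by
    intro n z
    refine Metric.ediam_le_iff.2 fun x hx y hy => ?_
    rw [edist_dist]
    refine ENNReal.ofReal_le_ofReal ?_
    have h1 := dist_triangle_right x y (z : ℂ)
    rw [Metric.mem_closedBall] at hx hy
    linarith
  have h0 : Tendsto (fun n => ENNReal.ofReal (2 * P.s n)) atTop (𝓝 0) := by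
    simpa using ENNReal.tendsto_ofReal (P.isScale_s.tendsto_zero.const_mul 2)
  refine (Measure.mkMetric_le_liminf_sum P.E (fun n => ENNReal.ofReal (2 * P.s n)) h0
    (fun n (z : P.Z n) => Metric.closedBall (z : ℂ) (P.s n)) (Eventually.of_forall hdiam)
    (Eventually.of_forall fun n x hx => ?_) m).trans ?_
  · obtain ⟨z, hz, h⟩ := P.mem_D.1 (Set.mem_iInter.1 hx n)
    exact Set.mem_iUnion.2 ⟨⟨z, hz⟩, by rwa [Metric.mem_closedBall, dist_eq_norm]⟩
  · have hle : ∀ n, ∑ z : P.Z n, m (Metric.ediam (Metric.closedBall (z : ℂ) (P.s n))) ≤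
        ENNReal.ofReal (P.N n * B n) := by
      intro n
      calc _ ≤ ∑ z : P.Z n, ENNReal.ofReal (B n) :=
            Finset.sum_le_sum fun z _ => hm n _ (hdiam n z)
        _ = (P.Z n).card * ENNReal.ofReal (B n) := by simp
        _ ≤ P.N n * ENNReal.ofReal (B n) := by
            gcongr
            exact P.card_Z_le n
        _ = _ := by rw [ENNReal.ofReal_mul (by positivity), ENNReal.ofReal_natCast]
    have h1 : Tendsto (fun n => ENNReal.ofReal (P.N n * B n)) atTop (𝓝 0) := by
      simpa using ENNReal.tendsto_ofReal hB
    exact (liminf_le_liminf (Eventually.of_forall hle)).trans h1.liminf_eq.le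

end CantorData

namespace CantorData

/-- The mass distribution principle: small sets satisfy `μ A ≤ f (diam A)`, so no covering can do
better than `μ`. -/
lemma μ_le_mkMetric (P : CantorData) {d b : ℝ} (hd : d ≤ 2)
    (hd0 : 0 < d) (hb : 0 < b) (hN : ∀ n, P.N n * P.t n ^ d = b ^ n) {f : ℝ → ℝ}
    (hf : Tendsto f (𝓝[>] 0) (𝓝 0)) {n₀ : ℕ}
    (hfb : ∀ n ≥ n₀, ∀ r, 0 < r → r < P.t n → r ^ d * (72 / b ^ n + 2 / b ^ (n + 1)) ≤ f r) :
    P.μ ≤ Measure.mkMetric fun x : ENNReal => ENNReal.ofReal (f x.toReal) := by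
  have ht := P.t_pos n₀
  have key : ∀ (A : Set ℂ) (r : ℝ), 0 < r → r < P.t n₀ → (∀ x ∈ A, ∀ y ∈ A, dist x y ≤ r) →
      P.μ A ≤ ENNReal.ofReal (f r) := by
    intro A r hr0 hr hA
    -- The least such `n` locates `r` in `[t (n + 1), t n)`.
    have hex : ∃ n, P.t (n + 1) ≤ r ∧ n₀ ≤ n := by
      have h1 := (P.isScale_t.tendsto_zero.comp (tendsto_add_atTop_nat 1)).eventually_lt_const hr0
      obtain ⟨n, hn, hn'⟩ := (h1.and (eventually_ge_atTop n₀)).exists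
      exact ⟨n, hn.le, hn'⟩
    classical
    obtain ⟨h1, h2⟩ := Nat.find_spec hex
    have h3 : r < P.t (Nat.find hex) := by
      rcases h2.eq_or_lt with h | h
      · rwa [← h]
      · obtain ⟨m, hm⟩ := Nat.exists_eq_succ_of_ne_zero (Nat.ne_zero_of_lt h)
        have h4 := Nat.find_min hex (m := m) (by omega)
        rw [hm]
        by_contra! h5
        exact h4 ⟨h5, by omega⟩
    exact (P.μ_le_of_forall_dist_le h1 h3 hA hd hd0 hb hN).trans
      (ENNReal.ofReal_le_ofReal (hfb _ h2 _ hr0 h3))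
  refine Measure.le_mkMetric _ _ (ENNReal.ofReal (P.t n₀ / 2)) (by simpa using ht) fun A hA => ?_
  have hfin : Metric.ediam A ≠ ⊤ := ne_top_of_le_ne_top ENNReal.ofReal_ne_top hA
  have hdist : ∀ x ∈ A, ∀ y ∈ A, dist x y ≤ (Metric.ediam A).toReal := by
    intro x hx y hy
    rw [dist_edist]
    exact ENNReal.toReal_mono hfin (Metric.edist_le_ediam_of_mem hx hy)
  have hlt : (Metric.ediam A).toReal < P.t n₀ := by
    have := ENNReal.toReal_mono ENNReal.ofReal_ne_top hA
    rw [ENNReal.toReal_ofReal (by positivity)] at this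
    linarith
  -- At diameter `0` nothing is known about `f 0`. The estimate is used for all small `r > 0`
  -- instead, and `f r → 0` gives `μ A = 0`.
  rcases ENNReal.toReal_nonneg.eq_or_lt' with h0 | h0
  · have h1 : P.μ A ≤ 0 := by
      have h2 : Tendsto (fun r => ENNReal.ofReal (f r)) (𝓝[>] 0) (𝓝 0) := by
        simpa using ENNReal.tendsto_ofReal hf
      refine ge_of_tendsto h2 ?_
      filter_upwards [Ioo_mem_nhdsGT ht] with r hr
      exact key A r hr.1 hr.2 fun x hx y hy => (hdist x hx y hy).trans (h0.trans_le hr.1.le)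
    exact h1.trans zero_le
  · exact key A _ h0 hlt hdist

lemma exists_of_thresholds {K d d' : ℝ} (hK : 1 ≤ K) (hd₀ : 0 < d) (hd₂ : d < 2)
    (hd' : d' = 2 * K * d / (2 + (K - 1) * d)) {q : ℝ} (hq : 0 < q) {τ : ℕ → ℝ}
    (hτ : ∀ n, 0 < τ n) :
    ∃ P : CantorData, P.K = K ∧ (∀ n, P.t (n + 1) ≤ τ n) ∧
      (∀ n, P.N n * P.t n ^ d' = (q ^ d' / 4) ^ n) ∧
      (∀ n, P.N n * P.s n ^ d = (q ^ (K * d) / 4) ^ n) := by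
  have hK0 : 0 < K := by linarith
  set γ : ℝ := (2 - d) / (K * d) with hγ
  have hγ0 : 0 < γ := div_pos (by linarith) (by positivity)
  have hR : Tendsto (fun k : ℕ => 1 / (2 * (k : ℝ))) atTop (𝓝 0) :=
    tendsto_const_nhds.div_atTop (tendsto_natCast_atTop_atTop.const_mul_atTop two_pos)
  have hσ : Tendsto (fun k : ℕ => q * (1 / (2 * (k : ℝ))) ^ γ) atTop (𝓝 0) := by
    have := (hR.rpow_const (p := γ) (Or.inr hγ0.le)).const_mul q
    rwa [Real.zero_rpow hγ0.ne', mul_zero] at this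
  -- Both `R` and `q * R ^ γ` tend to `0` as `k` grows, so even a large `q` is compatible with `σ ≤
  -- 1 / 2`.
  have hex : ∀ n, ∃ k : ℕ, 0 < k ∧ q * (1 / (2 * (k : ℝ))) ^ γ < 1 / 2 ∧
      1 / (2 * (k : ℝ)) < τ n := by
    intro n
    exact ((eventually_gt_atTop 0).and ((hσ.eventually_lt_const (by norm_num)).and
      (hR.eventually_lt_const (hτ n)))).exists
  choose k hk0 hkσ hkτ using hex
  have hk : ∀ n, 0 < (k n : ℝ) := fun n => by exact_mod_cast hk0 n
  let P : CantorData :=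
    { K := K, k := k, σ := fun n => q * (1 / (2 * (k n : ℝ))) ^ γ
      one_le_K := hK
      k_pos := hk0
      σ_pos := fun n => mul_pos hq (Real.rpow_pos_of_pos (by have := hk n; positivity) _)
      σ_le := fun n => (hkσ n).le }
  have hPσ : ∀ n, P.σ n = q * P.R n ^ γ := fun n => rfl
  have hkR : ∀ n, (P.k n : ℝ) ^ 2 = P.R n ^ (-2 : ℝ) / 4 := by
    intro n
    have h1 := P.R_pos n
    have h2 := P.k_pos' n
    rw [Real.rpow_neg h1.le, show (2 : ℝ) = (2 : ℕ) by norm_num, Real.rpow_natCast, R]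
    field_simp
    norm_num
  have hden : 0 < 2 + (K - 1) * d := by nlinarith
  -- The exponents of `R n` in one step then cancel: `-2 + d' + γ * d' = 0`. The analogous identity
  -- in the domain is `-2 + d + γ * (K * d) = 0`, and the remaining `1 / 4` comes from `k ^ 2 = R ^
  -- (-2) / 4`.
  have hd'' : d' = 2 - γ * d' := by
    have h1 : d' * (2 + (K - 1) * d) = 2 * K * d := by rw [hd', div_mul_cancel₀ _ hden.ne']
    have h2 : γ * (K * d) = 2 - d := div_mul_cancel₀ _ (by positivity)
    refine mul_left_cancel₀ (mul_pos hK0 hd₀).ne' ?_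
    linear_combination h1 + d' * h2
  refine ⟨P, rfl, fun n => ?_, fun n => ?_, fun n => ?_⟩
  · have h1 : P.t n ≤ 1 := P.isScale_t.antitone (Nat.zero_le n)
    have h2 := P.R_pos n
    have h3 := P.σ_pos n
    have h4 := (P.σ_lt_one n).le
    calc P.t (n + 1) = P.t n * (P.R n * P.σ n) := rfl
      _ ≤ 1 * (P.R n * 1) := by gcongr
      _ = P.R n := by ring
      _ ≤ τ n := (hkτ n).le
  · induction n with
    | zero => simp [N, t]
    | succ n ih =>
      have h1 := P.R_pos n
      have h2 := P.σ_pos n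
      have h3 := P.t_pos n
      have h4 : P.R n ^ (-2 : ℝ) * (P.R n ^ d' * P.R n ^ (γ * d')) = 1 := by
        rw [← Real.rpow_add h1, ← Real.rpow_add h1, ← Real.rpow_zero (P.R n)]
        congr 1; linarith
      have h5 : P.t (n + 1) ^ d' = P.t n ^ d' * (P.R n ^ d' * (q ^ d' * P.R n ^ (γ * d'))) := by
        change (P.t n * (P.R n * P.σ n)) ^ d' = _
        rw [Real.mul_rpow h3.le (by positivity), Real.mul_rpow h1.le h2.le, hPσ,
          Real.mul_rpow hq.le (by positivity), ← Real.rpow_mul h1.le]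
      rw [N_succ, h5, hkR, pow_succ, ← ih]
      linear_combination (P.N n * P.t n ^ d' * q ^ d' / 4) * h4
  · induction n with
    | zero => simp [N, s]
    | succ n ih =>
      have h1 := P.R_pos n
      have h2 := P.σ_pos n
      have h3 := P.s_pos n
      have h6 := P.σ_rpow_pos n
      have h4 : P.R n ^ (-2 : ℝ) * (P.R n ^ d * P.R n ^ (γ * (K * d))) = 1 := by
        rw [← Real.rpow_add h1, ← Real.rpow_add h1, ← Real.rpow_zero (P.R n)]
        congr 1; rw [hγ]; field_simp; ring
      have h5 : P.s (n + 1) ^ d =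
          P.s n ^ d * (P.R n ^ d * (q ^ (K * d) * P.R n ^ (γ * (K * d)))) := by
        change (P.s n * (P.R n * P.σ n ^ K)) ^ d = _
        rw [Real.mul_rpow h3.le (mul_nonneg h1.le h6.le), Real.mul_rpow h1.le h6.le,
          ← Real.rpow_mul h2.le, hPσ, Real.mul_rpow hq.le (by positivity), ← Real.rpow_mul h1.le]
      rw [N_succ, h5, hkR, pow_succ, ← ih]
      linear_combination (P.N n * P.s n ^ d * q ^ (K * d) / 4) * h4

/-- Since `b > 1`, the constants in the mass estimate tend to `0`, so `μ` is below every multiple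
`ε` of the Hausdorff measure. Countably many sets of finite measure are then `μ`-null and cannot
cover the image. -/
lemma not_sigmaFiniteOn (P : CantorData) {d b : ℝ} (hd : d ≤ 2) (hd0 : 0 < d) (hb : 1 < b)
    (hN : ∀ n, P.N n * P.t n ^ d = b ^ n) :
    ¬ SigmaFiniteOn (Measure.hausdorffMeasure d) (P.Φ '' P.E) := by
  rintro ⟨A, hA, hfin⟩
  have hb0 : 0 < b := by linarith
  have hle : ∀ ε : ℝ, 0 < ε → P.μ ≤ ENNReal.ofReal ε • Measure.hausdorffMeasure d := by
    intro ε hε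
    have h1 : Tendsto (fun n => 72 / b ^ n + 2 / b ^ (n + 1)) atTop (𝓝 0) := by
      have h2 := tendsto_pow_atTop_atTop_of_one_lt hb
      simpa using (tendsto_const_nhds (x := (72 : ℝ)).div_atTop h2).add
        ((tendsto_const_nhds (x := (2 : ℝ))).div_atTop (h2.comp (tendsto_add_atTop_nat 1)))
    obtain ⟨n₀, hn₀⟩ := eventually_atTop.1 (h1.eventually_lt_const hε)
    have h3 : Tendsto (fun r : ℝ => ε * r ^ d) (𝓝[>] 0) (𝓝 0) := by
      have h4 : Tendsto (fun r : ℝ => ε * r ^ d) (𝓝 0) (𝓝 (ε * 0 ^ d)) :=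
        ((Real.continuous_rpow_const hd0.le).const_mul ε).tendsto 0
      rw [Real.zero_rpow hd0.ne', mul_zero] at h4
      exact h4.mono_left nhdsWithin_le_nhds
    refine (P.μ_le_mkMetric hd hd0 hb0 hN h3 (n₀ := n₀) fun n hn r hr _ => ?_).trans
      (Measure.mkMetric_mono_smul ENNReal.ofReal_ne_top (by simpa using hε) ?_)
    · rw [mul_comm ε]
      have := Real.rpow_pos_of_pos hr d
      gcongr
      exact (hn₀ n hn).le
    · filter_upwards [mem_nhdsWithin_of_mem_nhds (Iio_mem_nhds ENNReal.zero_lt_top)] with x hx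
      have hx' : x = ENNReal.ofReal x.toReal := (ENNReal.ofReal_toReal (ne_of_lt hx)).symm
      rw [Pi.smul_apply, smul_eq_mul, ENNReal.ofReal_mul hε.le]
      conv_rhs => rw [hx', ENNReal.ofReal_rpow_of_nonneg ENNReal.toReal_nonneg hd0.le]
  have hzero : ∀ n, P.μ (A n) = 0 := by
    intro n
    have h1 : Tendsto (fun ε : ℝ => ENNReal.ofReal ε * Measure.hausdorffMeasure d (A n))
        (𝓝[>] 0) (𝓝 0) := by
      have h2 : Tendsto (fun ε : ℝ => ENNReal.ofReal ε) (𝓝[>] 0) (𝓝 0) := by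
        simpa using (ENNReal.continuous_ofReal.tendsto 0).mono_left nhdsWithin_le_nhds
      simpa using ENNReal.Tendsto.mul_const h2 (Or.inr (hfin n).ne)
    refine le_antisymm (ge_of_tendsto h1 ?_) zero_le
    filter_upwards [self_mem_nhdsWithin] with ε hε
    exact hle ε hε (A n)
  have h1 : P.μ (P.Φ '' P.E) = 0 := measure_mono_null hA (measure_iUnion_null hzero)
  have h2 := P.one_le_μ_image
  rw [h1] at h2
  exact absurd h2 (by simp)

end CantorData

/-! ### Proof of the theorem -/

lemma exists_forall_le_of_tendsto_div {u v : ℝ → ℝ}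
    (h : Tendsto (fun t => u t / v t) (𝓝[>] 0) (𝓝 0)) (hv : ∀ t, 0 < t → 0 < v t) {ε : ℝ}
    (hε : 0 < ε) : ∃ δ > 0, ∀ t, 0 < t → t ≤ δ → u t ≤ ε * v t := by
  obtain ⟨δ, hδ, hs⟩ := mem_nhdsGT_iff_exists_Ioc_subset.1 (h.eventually_lt_const hε)
  refine ⟨δ, hδ, fun t ht htδ => ?_⟩
  have h1 : u t / v t < ε := hs ⟨ht, htδ⟩
  exact ((div_lt_iff₀ (hv t ht)).1 h1).le

theorem theorem4p4 (K d d' : ℝ) (hK : 1 ≤ K) (hd₀ : 0 < d) (hd₂ : d < 2)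
    (hd' : d' = 2 * K * d / (2 + (K - 1) * d)) :
    (∀ h : ℝ → ℝ, IsGauge h → Tendsto (fun t : ℝ => t ^ d' / h t) (𝓝[>] 0) (𝓝 0) →
      ∃ (E : Set ℂ) (φ : ℂ ≃ₜ ℂ), IsCompact E ∧ IsQuasiconformal K φ ∧
        Measure.hausdorffMeasure d E = 0 ∧ 0 < gaugeHausdorffMeasure h (φ '' E)) ∧
    (∀ g : ℝ → ℝ, IsGauge g → Tendsto (fun t : ℝ => g t / t ^ d) (𝓝[>] 0) (𝓝 0) →
      ∃ (E : Set ℂ) (φ : ℂ ≃ₜ ℂ), IsCompact E ∧ IsQuasiconformal K φ ∧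
        gaugeHausdorffMeasure g E = 0 ∧
          ¬ SigmaFiniteOn (Measure.hausdorffMeasure d') (φ '' E)) := by
  have hK0 : 0 < K := by linarith
  have hden : 0 < 2 + (K - 1) * d := by nlinarith
  have hd'0 : 0 < d' := by rw [hd']; positivity
  have hd'2 : d' ≤ 2 := by
    rw [hd', div_le_iff₀ hden]; nlinarith
  refine ⟨fun h hh hlim => ?_, fun g hg hlim => ?_⟩
  -- This is the mass constant for `b = 1 / 4` at generation `n + 1`: the threshold `τ n` controls
  -- `t (n + 1)`, which is why the estimate below starts at `n₀ = 1`.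
  · have hc : ∀ n : ℕ, (0 : ℝ) < 72 / (1 / 4) ^ (n + 1) + 2 / (1 / 4) ^ (n + 1 + 1) :=
      fun n => by positivity
    choose τ hτ0 hτ using fun n => exists_forall_le_of_tendsto_div hlim hh.pos (inv_pos.2 (hc n))
    obtain ⟨P, hPK, hPt, hNt, hNs⟩ :=
      CantorData.exists_of_thresholds hK hd₀ hd₂ hd' one_pos hτ0
    rw [Real.one_rpow] at hNt hNs
    refine ⟨P.E, P.Φ, P.isCompact_E, hPK ▸ P.isQuasiconformal_Φ, ?_, ?_⟩
    · refine P.mkMetric_E_eq_zero (B := fun n => (2 * P.s n) ^ d) (fun n x hx => ?_) ?_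
      · rw [← ENNReal.ofReal_rpow_of_nonneg (by linarith [P.s_pos n]) hd₀.le]
        exact ENNReal.rpow_le_rpow hx hd₀.le
      · have h1 : ∀ n, P.N n * (2 * P.s n) ^ d = 2 ^ d * (1 / 4) ^ n := by
          intro n
          rw [← hNs, Real.mul_rpow zero_le_two (P.s_pos n).le]; ring
        simp only [h1]
        simpa using (tendsto_pow_atTop_nhds_zero_of_lt_one (r := (1 / 4 : ℝ)) (by norm_num)
          (by norm_num)).const_mul (2 ^ d)
    · have hμ : P.μ ≤ gaugeHausdorffMeasure h := by
        refine P.μ_le_mkMetric hd'2 hd'0 (by norm_num) hNt hh.tendsto_zero (n₀ := 1)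
          fun n hn r hr hrn => ?_
        obtain ⟨m, rfl⟩ := Nat.exists_eq_add_of_le' hn
        have h1 := hτ m r hr (hrn.le.trans (hPt m))
        rwa [inv_mul_eq_div, le_div_iff₀ (hc m)] at h1
      exact (one_pos.trans_le P.one_le_μ_image).trans_le (hμ _)
  -- Any `q` with `q ^ d' > 4` would make the target progression grow.
  · set q : ℝ := 16 ^ (1 / d') with hq
    have hq0 : 0 < q := by positivity
    have hqd : q ^ d' / 4 = 4 := by
      rw [hq, ← Real.rpow_mul (by norm_num), one_div_mul_cancel hd'0.ne', Real.rpow_one]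
      norm_num
    set a : ℝ := q ^ (K * d) / 4 with ha
    have ha0 : 0 < a := by positivity
    -- The progression in the domain is `a ^ n`; the factor `(2 a)^(-(n + 1))` gained from `g`
    -- outweighs it and leaves `(1 / 2)^(n + 1)`.
    have hc : ∀ n : ℕ, 0 < ((2 * a) ^ (n + 1))⁻¹ := fun n => by positivity
    choose τ hτ0 hτ using fun n => exists_forall_le_of_tendsto_div hlim
      (fun t ht => Real.rpow_pos_of_pos ht d) (hc n)
    obtain ⟨P, hPK, hPt, hNt, hNs⟩ := CantorData.exists_of_thresholds hK hd₀ hd₂ hd' hq0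
      -- Halved because the gauge is evaluated at the diameter bound `2 * s (n + 1) ≤ 2 * t (n +
      -- 1)`.
      (τ := fun n => τ n / 2) fun n => half_pos (hτ0 n)
    rw [hqd] at hNt
    refine ⟨P.E, P.Φ, P.isCompact_E, hPK ▸ P.isQuasiconformal_Φ, ?_,
      P.not_sigmaFiniteOn hd'2 hd'0 (by norm_num) hNt⟩
    refine P.mkMetric_E_eq_zero (B := fun n => g (2 * P.s n)) (fun n x hx => ?_) ?_
    · have h2s : 0 ≤ 2 * P.s n := by linarith [P.s_pos n]
      refine ENNReal.ofReal_le_ofReal (hg.monotoneOn ENNReal.toReal_nonneg h2s ?_)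
      exact ENNReal.toReal_le_of_le_ofReal h2s hx
    · refine (tendsto_add_atTop_iff_nat 1).1 ?_
      have h0 : Tendsto (fun n : ℕ => (2 : ℝ) ^ d * (1 / 2) ^ (n + 1)) atTop (𝓝 0) := by
        simpa using ((tendsto_pow_atTop_nhds_zero_of_lt_one (r := (1 / 2 : ℝ)) (by norm_num)
          (by norm_num)).comp (tendsto_add_atTop_nat 1)).const_mul (2 ^ d)
      refine squeeze_zero (fun n => ?_) (fun n => ?_) h0
      · have := hg.pos (2 * P.s (n + 1)) (by linarith [P.s_pos (n + 1)])
        positivity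
      · have hs := P.s_pos (n + 1)
        have h1 := hτ n (2 * P.s (n + 1)) (by linarith)
          (by linarith [P.s_le_t (n + 1), hPt n])
        calc P.N (n + 1) * g (2 * P.s (n + 1))
            ≤ P.N (n + 1) * (((2 * a) ^ (n + 1))⁻¹ * (2 * P.s (n + 1)) ^ d) := by gcongr
          _ = 2 ^ d * ((2 * a) ^ (n + 1))⁻¹ * (P.N (n + 1) * P.s (n + 1) ^ d) := by
              rw [Real.mul_rpow zero_le_two hs.le]; ring
          _ = 2 ^ d * (1 / 2) ^ (n + 1) := by
              rw [hNs, ← ha, mul_pow, one_div, inv_pow]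
              field_simp
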